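/- Let $(W,S)$ be a Coxeter system ($S$ possibly infinite), let $T=\bigcup_{w\in W}wSw^{-1}$ be its set of reflections, let $\ell_T(w)$ be the least number of reflections whose product is $w$, and let $\leq_T$ be the partial order on $W$ given by $v\leq_T w \Leftrightarrow \ell_T(v)+\ell_T(v^{-1}w)=\ell_T(w)$; write $[1,w]_T=\{v\in W \mid 1\leq_T v\leq_T w\}$. A parabolic subgroup is a subgroup $wW_Iw^{-1}$ with $w\in W$, $I\subseteq S$, $W_I=\langle I\rangle$; it is called irreducible if $w,I$ can be chosen such that the Coxeter graph of $I$ is nonempty and connected. For $w\in W$ let $P(w)$, the parabolic closure of $w$, be the intersection of all parabolic subgroups containing $w$. Let $u\in W$ be an involution, meaning $u^2=1$ (the case $u=1$ is allowed, and then $k=0$ below). Then $P(u)$ is a parabolic subgroup, hence the smallest one containing $u$, and it is finite. There are an integer $k\geq 0$ and pairwise commuting involutions $u_1,\dots,u_k\in W$ such that $u=u_1u_2\cdots u_k$, each $P(u_i)$ is an irreducible parabolic subgroup, and $$P(u)=P(u_1)\times P(u_2)\times\cdots\times P(u_k)$$ as an internal direct product of subgroups. The number $k$ and the $u_i$ with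 these properties are unique up to reordering. Moreover, the poset $[1,u]_T$ is the direct product of the posets $[1,u_i]_T$: the map $(x_1,\dots,x_k)\mapsto x_1x_2\cdots x_k$ is an isomorphism of posets from $\prod_{i=1}^k[1,u_i]_T$ with the componentwise order onto $[1,u]_T$, where all intervals are ordered by $\leq_T$. -/

import Mathlib

namespace CoxeterMatrix

/-- The Coxeter graph (without labels): distinct `i`, `j` are joined when `M i j ≠ 2`. In
Mathlib's convention `M i j = 0` encodes `m(i, j) = ∞`, so such a pair is joined as well. -/
def coxeterGraph {B : Type*} (M : CoxeterMatrix B) : SimpleGraph B where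
  Adj i j := i ≠ j ∧ M i j ≠ 2
  symm := ⟨fun i j h => ⟨h.1.symm, by rw [M.symmetric]; exact h.2⟩⟩
  loopless := ⟨fun _ h => h.1 rfl⟩

end CoxeterMatrix

/-- `K` is the internal direct product of the family of subgroups `H`: different members of the
family commute elementwise, and multiplication is an isomorphism from `∏ i, H i` onto `K`. -/
def Subgroup.IsInternalDirectProduct {G ι : Type*} [Group G] [Fintype ι]
    (H : ι → Subgroup G) (K : Subgroup G) : Prop :=
  ∃ hcomm : Pairwise fun i j => ∀ x y : G, x ∈ H i → y ∈ H j → Commute x y,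
    Function.Injective (Subgroup.noncommPiCoprod hcomm) ∧
      (Subgroup.noncommPiCoprod hcomm).range = K

namespace CoxeterSystem

variable {B W : Type*} [Group W] {M : CoxeterMatrix B} (cs : CoxeterSystem M W)

/-- The standard parabolic subgroup `W_I`. -/
def standardParabolic (I : Set B) : Subgroup W :=
  Subgroup.closure (cs.simple '' I)

/-- The parabolic subgroup `w W_I w⁻¹`. -/
def conjParabolic (w : W) (I : Set B) : Subgroup W :=
  (cs.standardParabolic I).map (MulAut.conj w).toMonoidHom

def IsParabolic (P : Subgroup W) : Prop :=
  ∃ (w : W) (I : Set B), P = cs.conjParabolic w I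

/-- A parabolic subgroup is irreducible if it is of the form `w W_I w⁻¹` where the Coxeter graph
of `W_I` is connected (in particular, nonempty). -/
def IsIrreducibleParabolic (P : Subgroup W) : Prop :=
  ∃ (w : W) (I : Set B), P = cs.conjParabolic w I ∧ (M.coxeterGraph.induce I).Connected

/-- The parabolic closure `P(w)`: the intersection of all parabolic subgroups containing `w`. -/
def parabolicClosure (w : W) : Subgroup W :=
  sInf {P : Subgroup W | cs.IsParabolic P ∧ w ∈ P}

/-- The reflection length `ℓ_T`. -/
noncomputable def reflectionLength (w : W) : ℕ :=
  sInf {k : ℕ | ∃ l : List W, l.length = k ∧ (∀ t ∈ l, cs.IsReflection t) ∧ l.prod = w}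

/-- The absolute order `≤_T`. -/
def AbsLE (v w : W) : Prop :=
  cs.reflectionLength v + cs.reflectionLength (v⁻¹ * w) = cs.reflectionLength w

theorem exists_reflectionWord (w : W) : ∃ l : List W, l.length = cs.reflectionLength w ∧
    (∀ t ∈ l, cs.IsReflection t) ∧ l.prod = w := by
  refine Nat.sInf_mem
    (s := {k : ℕ | ∃ l : List W, l.length = k ∧ (∀ t ∈ l, cs.IsReflection t) ∧ l.prod = w}) ?_
  obtain ⟨ω, rfl⟩ := cs.wordProd_surjective w
  refine ⟨_, ω.map cs.simple, rfl, ?_, rfl⟩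
  intro t ht
  obtain ⟨i, -, rfl⟩ := List.mem_map.1 ht
  exact cs.isReflection_simple i

theorem reflectionLength_prod_le (l : List W) (hl : ∀ t ∈ l, cs.IsReflection t) :
    cs.reflectionLength l.prod ≤ l.length :=
  Nat.sInf_le ⟨l, rfl, hl, rfl⟩

theorem reflectionLength_one : cs.reflectionLength 1 = 0 := by
  simpa using cs.reflectionLength_prod_le [] (by simp)

theorem reflectionLength_eq_zero {w : W} (h : cs.reflectionLength w = 0) : w = 1 := by
  obtain ⟨l, hl, -, rfl⟩ := cs.exists_reflectionWord w
  rw [h, List.length_eq_zero_iff] at hl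
  simp [hl]

theorem reflectionLength_mul_le (v w : W) :
    cs.reflectionLength (v * w) ≤ cs.reflectionLength v + cs.reflectionLength w := by
  obtain ⟨l, hl, hl', hlv⟩ := cs.exists_reflectionWord v
  obtain ⟨m, hm, hm', hmw⟩ := cs.exists_reflectionWord w
  have h := cs.reflectionLength_prod_le (l ++ m) (by
    intro t ht
    rcases List.mem_append.1 ht with ht | ht
    · exact hl' t ht
    · exact hm' t ht)
  rw [List.prod_append, hlv, hmw, List.length_append] at h
  omega

theorem AbsLE.rfl (w : W) : cs.AbsLE w w := by
  simp [AbsLE, reflectionLength_one]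

theorem AbsLE.trans {v w x : W} (h₁ : cs.AbsLE v w) (h₂ : cs.AbsLE w x) : cs.AbsLE v x := by
  unfold AbsLE at *
  have h₃ := cs.reflectionLength_mul_le (v⁻¹ * w) (w⁻¹ * x)
  have h₄ := cs.reflectionLength_mul_le v (v⁻¹ * x)
  rw [show v⁻¹ * w * (w⁻¹ * x) = v⁻¹ * x by group] at h₃
  rw [mul_inv_cancel_left] at h₄
  omega

theorem AbsLE.antisymm {v w : W} (h₁ : cs.AbsLE v w) (h₂ : cs.AbsLE w v) : v = w := by
  unfold AbsLE at *
  have h : v⁻¹ * w = 1 := cs.reflectionLength_eq_zero (by omega)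
  exact inv_mul_eq_one.1 h

/-- The interval `[v, w]_T` for the absolute order. -/
def AbsInterval (v w : W) : Type _ :=
  {x : W // cs.AbsLE v x ∧ cs.AbsLE x w}

/-- `[v, w]_T` is a poset for the absolute order. -/
instance (v w : W) : PartialOrder (cs.AbsInterval v w) where
  le x y := cs.AbsLE x.1 y.1
  le_refl x := AbsLE.rfl cs x.1
  le_trans _ _ _ := AbsLE.trans cs
  le_antisymm _ _ h₁ h₂ := Subtype.ext (AbsLE.antisymm cs h₁ h₂)

/-- The family `v` consists of pairwise commuting involutions with product `u`, whose parabolic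
closures are irreducible and such that `P(u) = P(v 0) × ⋯ × P(v (k - 1))`. -/
structure IsInvolutionDecomposition (u : W) {k : ℕ} (v : Fin k → W) : Prop where
  sq_eq_one : ∀ i, v i ^ 2 = 1
  commute : ∀ i j, Commute (v i) (v j)
  prod_eq : (List.ofFn v).prod = u
  irreducible : ∀ i, cs.IsIrreducibleParabolic (cs.parabolicClosure (v i))
  directProduct :
    Subgroup.IsInternalDirectProduct (fun i => cs.parabolicClosure (v i)) (cs.parabolicClosure u)

end CoxeterSystem

/-! Let `W` act on the space spanned by the simple roots `αᵢ` (the geometric representation). By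
Richardson's theorem an involution `u` lies in a finite parabolic subgroup `g W_I g⁻¹` on whose
roots it acts as `-1`. The roots of any parabolic subgroup containing `u` then span a space
containing the roots `g αᵢ`, `i ∈ I`, and a root in the root span of a parabolic subgroup has its
reflection in that subgroup; hence `P(u) = g W_I g⁻¹`. The connected components of the Coxeter graph
of `I` give the factors of `P(u)`, and the `uᵢ` are the components of `u`.

A reflection in a direct product of parabolic subgroups lies in one of the factors, and the roots
of different factors are orthogonal. So an irreducible parabolic subgroup of `P(u)` is contained in
a single factor, which gives uniqueness.

For the absolute order, the reflection length of `u` is the dimension of the image of `u - 1`, which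
is the root span of `P(u)`. By counting dimensions, the letters of a shortest factorization of `u`
into reflections lie in `P(u)`, hence so do those of every `x ≤_T u`. Sorting the letters by factors
shows that `ℓ_T` is additive over the factors for elements below `u`.
-/

namespace Subgroup.IsInternalDirectProduct

variable {G ι : Type*} [Group G] [Fintype ι] {H : ι → Subgroup G} {K : Subgroup G}

theorem commute (h : IsInternalDirectProduct H K) {i j : ι} (hij : i ≠ j) {x y : G}
    (hx : x ∈ H i) (hy : y ∈ H j) : Commute x y :=
  h.1 hij x y hx hy

theorem iSup_eq (h : IsInternalDirectProduct H K) : ⨆ i, H i = K := by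
  rw [← h.2.2, noncommPiCoprod_range]

theorem le (h : IsInternalDirectProduct H K) (i : ι) : H i ≤ K :=
  h.iSup_eq ▸ le_iSup H i

/-- The isomorphism from the external to the internal direct product, given by multiplication. -/
noncomputable def mulEquiv (h : IsInternalDirectProduct H K) : (∀ i, H i) ≃* K :=
  (MonoidHom.ofInjective h.2.1).trans (MulEquiv.subgroupCongr h.2.2)

theorem coe_mulEquiv_apply (h : IsInternalDirectProduct H K) (f : ∀ i, H i) :
    (h.mulEquiv f : G) = Finset.univ.noncommProd (fun i => (f i : G))
      fun i _ j _ hij => h.commute hij (f i).2 (f j).2 :=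
  noncommPiCoprod_apply h.1 f

theorem coe_mulEquiv_eq_prod_ofFn {k : ℕ} {H : Fin k → Subgroup G}
    (h : IsInternalDirectProduct H K) (f : ∀ i, H i) :
    (h.mulEquiv f : G) = (List.ofFn fun i => (f i : G)).prod := by
  rw [coe_mulEquiv_apply, List.ofFn_eq_map]
  simp only [← List.toFinset_finRange]
  rw [Finset.noncommProd_toFinset _ _ _ (List.nodup_finRange k)]

theorem coe_mulEquiv_mulSingle [DecidableEq ι] (h : IsInternalDirectProduct H K) (i : ι)
    (x : H i) : (h.mulEquiv (Pi.mulSingle i x) : G) = x :=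
  noncommPiCoprod_mulSingle (hcomm := h.1) i x

theorem inv_mul_mulEquiv_mem (h : IsInternalDirectProduct H K) (f : ∀ i, H i) {i : ι}
    {L : Subgroup G} (hL : ∀ j ≠ i, H j ≤ L) : (f i : G)⁻¹ * h.mulEquiv f ∈ L := by
  classical
  have hf : f = Pi.mulSingle i (f i) * Function.update f i 1 := by
    funext j
    rcases eq_or_ne j i with rfl | hj
    · simp
    · simp [hj]
  rw [congrArg h.mulEquiv hf, map_mul, coe_mul, coe_mulEquiv_mulSingle, inv_mul_cancel_left,
    coe_mulEquiv_apply]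
  refine noncommProd_mem _ _ fun j _ => ?_
  rcases eq_or_ne j i with rfl | hj
  · simp [one_mem]
  · rw [Function.update_of_ne hj]
    exact hL j hj (f j).2

theorem eq_one_of_mem_of_mem (h : IsInternalDirectProduct H K) {i j : ι} (hij : i ≠ j) {x : G}
    (hi : x ∈ H i) (hj : x ∈ H j) : x = 1 := by
  classical
  have heq : (Pi.mulSingle i ⟨x, hi⟩ : ∀ i, H i) = Pi.mulSingle j ⟨x, hj⟩ :=
    h.mulEquiv.injective (Subtype.ext (by simp only [coe_mulEquiv_mulSingle]))
  have := congrFun heq i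
  rw [Pi.mulSingle_eq_same, Pi.mulSingle_eq_of_ne hij] at this
  exact congrArg Subtype.val this

end Subgroup.IsInternalDirectProduct

namespace CoxeterInvolution

open CoxeterSystem Polynomial.Chebyshev

/-! ### The geometric representation -/

theorem chebyshevS_eval_two_mul_cos {θ : ℝ} (hθ : Real.sin θ ≠ 0) (n : ℤ) :
    (S ℝ n).eval (2 * Real.cos θ) = Real.sin ((n + 1) * θ) / Real.sin θ := by
  rw [eq_div_iff hθ, S_two_mul_real_cos]

theorem sin_pi_div_natCast_pos {m : ℕ} (hm : 2 ≤ m) : 0 < Real.sin (Real.pi / m) := by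
  have hm' : (1 : ℝ) < m := by exact_mod_cast hm
  exact Real.sin_pos_of_pos_of_lt_pi (by positivity) (div_lt_self Real.pi_pos hm')

theorem chebyshevS_eval_two_mul_cos_pi_div_nonneg {m : ℕ} (hm : m ≠ 1) {k : ℕ}
    (hk : m = 0 ∨ k ≤ m) : 0 ≤ (S ℝ ((k : ℤ) - 1)).eval (2 * Real.cos (Real.pi / m)) := by
  rcases eq_or_ne m 0 with rfl | h0
  · simp
  · have hkm : (k : ℝ) ≤ m := by exact_mod_cast hk.resolve_left h0
    have hsin := sin_pi_div_natCast_pos (m := m) (by lia)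
    rw [chebyshevS_eval_two_mul_cos hsin.ne']
    push_cast
    rw [sub_add_cancel]
    refine div_nonneg (Real.sin_nonneg_of_nonneg_of_le_pi (by positivity) ?_) hsin.le
    rw [mul_div_assoc', div_le_iff₀ (by positivity), mul_comm Real.pi]
    gcongr

theorem chebyshevS_eval_eq_zero_of_mul_eq_pi {θ : ℝ} (hθ : Real.sin θ ≠ 0) {k : ℕ}
    (h : k * θ = Real.pi) : (S ℝ ((k : ℤ) - 1)).eval (2 * Real.cos θ) = 0 := by
  rw [chebyshevS_eval_two_mul_cos hθ]
  simp [h]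

theorem chebyshevS_eval_add_eq_zero_of_mul_eq_two_pi {θ : ℝ} (hθ : Real.sin θ ≠ 0) {k : ℕ}
    (h : (2 * k + 1) * θ = 2 * Real.pi) :
    (S ℝ (k : ℤ)).eval (2 * Real.cos θ) + (S ℝ ((k : ℤ) - 1)).eval (2 * Real.cos θ) = 0 := by
  have hk : (((k : ℤ) : ℝ) + 1) * θ = 2 * Real.pi - (((k : ℤ) - 1 : ℤ) + 1 : ℝ) * θ := by
    push_cast
    linarith
  rw [chebyshevS_eval_two_mul_cos hθ, chebyshevS_eval_two_mul_cos hθ, hk, Real.sin_two_pi_sub]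
  ring

section Reflections

variable {V : Type*} [AddCommGroup V] [Module ℝ V] {x y : V} {f g : Module.Dual ℝ V}

theorem reflection_mul_reflection_sq_eq_one (hf : f x = 2) (hg : g y = 2) (hfy : f y = 0)
    (hgx : g x = 0) : (Module.reflection hf * Module.reflection hg) ^ 2 = 1 := by
  ext v
  simp only [pow_two, LinearEquiv.mul_apply, Module.reflection_apply, map_sub, map_smul, hf, hg,
    hfy, hgx, LinearEquiv.coe_one, id]
  module

theorem reflection_mul_reflection_pow_eq_one (hf : f x = 2) (hg : g y = 2) {m : ℕ} (hm : 3 ≤ m)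
    (h : f y * g x = 4 * Real.cos (Real.pi / m) ^ 2) :
    (Module.reflection hf * Module.reflection hg) ^ m = 1 := by
  set θ : ℝ := 2 * (Real.pi / m)
  have hm0 : (m : ℝ) ≠ 0 := by positivity
  have hmθ : m * θ = 2 * Real.pi := by simp only [θ]; field_simp
  have htrace : f y * g x - 2 = 2 * Real.cos θ := by rw [h, Real.cos_two_mul]; ring
  have hsin : Real.sin θ ≠ 0 := by
    have hm3 : (3 : ℝ) ≤ m := by exact_mod_cast hm
    refine (Real.sin_pos_of_pos_of_lt_pi (by positivity) ?_).ne'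
    nlinarith [Real.pi_pos]
  ext v
  rw [Module.reflection_mul_reflection_pow_apply hf hg, htrace]
  obtain ⟨k, rfl | rfl⟩ := Nat.even_or_odd' m
  · have hS := chebyshevS_eval_eq_zero_of_mul_eq_pi hsin (k := k) (by push_cast at hmθ; linarith)
    rw [show (((2 * k : ℕ) : ℤ) - 2) / 2 = k - 1 by lia,
      show (((2 * k : ℕ) : ℤ) - 1) / 2 = k - 1 by lia, hS]
    simp
  · have hS := chebyshevS_eval_add_eq_zero_of_mul_eq_two_pi hsin (k := k)
      (by push_cast at hmθ; exact hmθ)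
    rw [show (((2 * k + 1 : ℕ) : ℤ) - 1) / 2 = k by lia,
      show (((2 * k + 1 : ℕ) : ℤ) - 3) / 2 = k - 1 by lia,
      show ((2 * k + 1 : ℕ) : ℤ) / 2 = k by lia,
      show (((2 * k + 1 : ℕ) : ℤ) - 2) / 2 = k - 1 by lia, hS]
    simp

end Reflections

section RootForm

variable {B : Type*} (M : CoxeterMatrix B)

/-- The simple root `αᵢ`, a basis vector of the space of the geometric representation. -/
noncomputable def simpleRoot (i : B) : B →₀ ℝ := Finsupp.single i 1

theorem simpleRoot_nonneg (i : B) : 0 ≤ simpleRoot i :=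
  Finsupp.single_nonneg.2 zero_le_one

theorem simpleRoot_ne_zero (i : B) : simpleRoot i ≠ 0 := by
  simp [simpleRoot]

theorem linearMap_ext_simpleRoot {V : Type*} [AddCommMonoid V] [Module ℝ V]
    {f g : (B →₀ ℝ) →ₗ[ℝ] V} (h : ∀ i, f (simpleRoot i) = g (simpleRoot i)) : f = g :=
  Finsupp.lhom_ext' fun i => LinearMap.ext_ring (h i)

/-- The symmetric bilinear form `B(αᵢ, αⱼ) = -cos (π / m(i, j))` preserved by the geometric
representation. Since `π / 0 = 0`, the entry `m(i, j) = ∞`, encoded as `0`, gives `-1`. -/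
noncomputable def rootForm : (B →₀ ℝ) →ₗ[ℝ] (B →₀ ℝ) →ₗ[ℝ] ℝ :=
  Finsupp.linearCombination ℝ fun i =>
    Finsupp.linearCombination ℝ fun j => -Real.cos (Real.pi / M i j)

theorem rootForm_simpleRoot (i j : B) :
    rootForm M (simpleRoot i) (simpleRoot j) = -Real.cos (Real.pi / M i j) := by
  simp [rootForm, simpleRoot]

theorem rootForm_simpleRoot_self (i : B) : rootForm M (simpleRoot i) (simpleRoot i) = 1 := by
  simp [rootForm_simpleRoot]

theorem rootForm_comm (x y : B →₀ ℝ) : rootForm M x y = rootForm M y x := by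
  have h : rootForm M = (rootForm M).flip :=
    linearMap_ext_simpleRoot fun i => linearMap_ext_simpleRoot fun j => by
      rw [LinearMap.flip_apply, rootForm_simpleRoot, rootForm_simpleRoot, M.symmetric]
  exact LinearMap.congr_fun₂ h x y

theorem rootForm_simpleRoot_eq_zero_iff {i j : B} :
    rootForm M (simpleRoot i) (simpleRoot j) = 0 ↔ M i j = 2 := by
  rw [rootForm_simpleRoot, neg_eq_zero]
  refine ⟨fun h => ?_, fun h => by simp [h]⟩
  have h0 : M i j ≠ 0 := fun h0 => by simp [h0] at h
  have h1 : M i j ≠ 1 := fun h1 => by simp [h1] at h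
  by_contra h2
  have h3 : (3 : ℝ) ≤ M i j := by exact_mod_cast (by lia : 3 ≤ M i j)
  have hlt : Real.pi / M i j < Real.pi / 2 := by
    gcongr
    linarith
  have hpos : 0 < Real.pi / M i j := by positivity
  exact (Real.cos_pos_of_mem_Ioo ⟨by linarith [Real.pi_pos], hlt⟩).ne' h

/-- The simple coroot `2 B(αᵢ, ·)`. -/
noncomputable def simpleCoroot (i : B) : Module.Dual ℝ (B →₀ ℝ) :=
  (2 : ℝ) • rootForm M (simpleRoot i)

theorem simpleCoroot_apply (i : B) (v : B →₀ ℝ) :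
    simpleCoroot M i v = 2 * rootForm M (simpleRoot i) v := rfl

theorem simpleCoroot_self (i : B) : simpleCoroot M i (simpleRoot i) = 2 := by
  rw [simpleCoroot_apply, rootForm_simpleRoot_self, mul_one]

/-- The reflection of the geometric representation in the simple root `αᵢ`. -/
noncomputable def simpleReflection (i : B) : (B →₀ ℝ) ≃ₗ[ℝ] (B →₀ ℝ) :=
  Module.reflection (simpleCoroot_self M i)

theorem isLiftable_simpleReflection : M.IsLiftable (simpleReflection M) := by
  intro i j
  rcases eq_or_ne i j with rfl | hij
  · rw [M.diagonal, pow_one]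
    ext1 v
    exact Module.involutive_reflection (simpleCoroot_self M i) v
  have h1 : M i j ≠ 1 := M.off_diagonal i j hij
  obtain h0 | h2 | h3 : M i j = 0 ∨ M i j = 2 ∨ 3 ≤ M i j := by lia
  · rw [h0, pow_zero]
  · rw [h2]
    apply reflection_mul_reflection_sq_eq_one <;> rw [simpleCoroot_apply]
    · rw [(rootForm_simpleRoot_eq_zero_iff M).2 h2, mul_zero]
    · rw [rootForm_comm, (rootForm_simpleRoot_eq_zero_iff M).2 h2, mul_zero]
  · refine reflection_mul_reflection_pow_eq_one _ _ h3 ?_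
    rw [simpleCoroot_apply, simpleCoroot_apply, rootForm_comm M (simpleRoot j),
      rootForm_simpleRoot]
    ring

end RootForm

variable {B W : Type*} [Group W] {M : CoxeterMatrix B} (cs : CoxeterSystem M W)

section GeometricRepresentation

/-- The geometric representation of `W` on the real vector space with basis the simple roots. -/
noncomputable def geomRep : W →* ((B →₀ ℝ) ≃ₗ[ℝ] (B →₀ ℝ)) :=
  cs.lift ⟨simpleReflection M, isLiftable_simpleReflection M⟩

theorem geomRep_simple (i : B) (v : B →₀ ℝ) : geomRep cs (cs.simple i) v =
    v - (2 * rootForm M (simpleRoot i) v) • simpleRoot i := by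
  rw [geomRep, lift_apply_simple]
  exact Module.reflection_apply _ _

theorem geomRep_mul_apply (x y : W) (v : B →₀ ℝ) :
    geomRep cs (x * y) v = geomRep cs x (geomRep cs y v) := by
  rw [map_mul, LinearEquiv.mul_apply]

@[simp]
theorem geomRep_one_apply (v : B →₀ ℝ) : geomRep cs 1 v = v := by
  rw [map_one, LinearEquiv.coe_one, id]

@[simp]
theorem geomRep_inv_apply_apply (x : W) (v : B →₀ ℝ) : geomRep cs x⁻¹ (geomRep cs x v) = v := by
  rw [← geomRep_mul_apply, inv_mul_cancel, geomRep_one_apply]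

@[simp]
theorem geomRep_apply_inv_apply (x : W) (v : B →₀ ℝ) : geomRep cs x (geomRep cs x⁻¹ v) = v := by
  rw [← geomRep_mul_apply, mul_inv_cancel, geomRep_one_apply]

theorem geomRep_simple_simpleRoot (i : B) :
    geomRep cs (cs.simple i) (simpleRoot i) = -simpleRoot i := by
  rw [geomRep_simple, rootForm_simpleRoot_self]
  module

theorem rootForm_geomRep (w : W) (x y : B →₀ ℝ) :
    rootForm M (geomRep cs w x) (geomRep cs w y) = rootForm M x y := by
  induction w using cs.simple_induction_left generalizing x y with
  | one => simp
  | mul_simple_left w i ih =>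
    rw [geomRep_mul_apply, geomRep_mul_apply, ← ih x y, geomRep_simple, geomRep_simple]
    simp only [map_sub, map_smul, LinearMap.sub_apply, LinearMap.smul_apply, smul_eq_mul,
      rootForm_simpleRoot_self, rootForm_comm M _ (simpleRoot i)]
    ring

theorem geomRep_conj_simple (x : W) (i : B) (v : B →₀ ℝ) :
    geomRep cs (x * cs.simple i * x⁻¹) v =
      v - (2 * rootForm M (geomRep cs x (simpleRoot i)) v) • geomRep cs x (simpleRoot i) := by
  rw [geomRep_mul_apply, geomRep_mul_apply, geomRep_simple, map_sub, map_smul,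
    geomRep_apply_inv_apply, ← rootForm_geomRep cs x, geomRep_apply_inv_apply]

theorem geomRep_simpleRoot_ne_zero (w : W) (i : B) : geomRep cs w (simpleRoot i) ≠ 0 := by
  rw [Ne, LinearEquiv.map_eq_zero_iff]
  exact simpleRoot_ne_zero i

theorem geomRep_alternatingWord_simpleRoot (i j : B) (k : ℕ) :
    geomRep cs (cs.wordProd (alternatingWord i j k)) (simpleRoot i) =
      if Even k then
        (S ℝ (k : ℤ)).eval (2 * Real.cos (Real.pi / M i j)) • simpleRoot i +
        (S ℝ ((k : ℤ) - 1)).eval (2 * Real.cos (Real.pi / M i j)) • simpleRoot j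
      else
        (S ℝ ((k : ℤ) - 1)).eval (2 * Real.cos (Real.pi / M i j)) • simpleRoot i +
        (S ℝ (k : ℤ)).eval (2 * Real.cos (Real.pi / M i j)) • simpleRoot j := by
  induction k with
  | zero => simp [alternatingWord]
  | succ k ih =>
    have hS : (S ℝ ((k : ℤ) + 1)).eval (2 * Real.cos (Real.pi / M i j)) =
        2 * Real.cos (Real.pi / M i j) *
          (S ℝ (k : ℤ)).eval (2 * Real.cos (Real.pi / M i j)) -
        (S ℝ ((k : ℤ) - 1)).eval (2 * Real.cos (Real.pi / M i j)) := by
      simp [S_add_one]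
    rw [alternatingWord_succ', wordProd_cons, geomRep_mul_apply, ih]
    push_cast
    rw [add_sub_cancel_right, hS]
    by_cases hk : Even k
    · rw [if_pos hk, if_pos hk, if_neg (by simpa [Nat.even_add_one] using hk), map_add, map_smul,
        map_smul, geomRep_simple_simpleRoot, geomRep_simple, rootForm_simpleRoot, M.symmetric j i]
      module
    · rw [if_neg hk, if_neg hk, if_pos (by simpa [Nat.even_add_one] using hk), map_add, map_smul,
        map_smul, geomRep_simple_simpleRoot, geomRep_simple, rootForm_simpleRoot]
      module

end GeometricRepresentation

section DihedralFactorization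

variable {cs}

theorem eq_mul_wordProd_alternatingWord_succ {v w : W} {i j : B} {k : ℕ}
    (hw : w = v * cs.wordProd (alternatingWord i j k)) :
    w = v * cs.simple (if Even k then j else i) *
      cs.wordProd (alternatingWord i j (k + 1)) := by
  rw [alternatingWord_succ', wordProd_cons, ← mul_assoc, simple_mul_simple_cancel_right, hw]

theorem length_mul_wordProd_alternatingWord_le (v : W) (i j : B) (k : ℕ) :
    cs.length (v * cs.wordProd (alternatingWord i j k)) ≤ cs.length v + k :=
  (cs.length_mul_le _ _).trans <| Nat.add_le_add_left
    ((cs.length_wordProd_le _).trans_eq (length_alternatingWord i j k)) _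

theorem not_isRightDescent_of_length_eq_add_succ {v w : W} {i j : B} {k : ℕ}
    (hw : w = v * cs.wordProd (alternatingWord i j (k + 1)))
    (hlen : cs.length w = cs.length v + (k + 1)) :
    ¬ cs.IsRightDescent v (if Even k then j else i) := by
  intro hd
  rw [alternatingWord_succ', wordProd_cons, ← mul_assoc] at hw
  have hle := length_mul_wordProd_alternatingWord_le (cs := cs)
    (v * cs.simple (if Even k then j else i)) i j k
  rw [← hw] at hle
  rw [isRightDescent_iff] at hd
  lia

theorem exists_eq_mul_wordProd_alternatingWord {w : W} {i j : B} (hj : cs.IsRightDescent w j) :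
    ∃ (v : W) (k : ℕ), w = v * cs.wordProd (alternatingWord i j (k + 1)) ∧
      cs.length w = cs.length v + (k + 1) ∧
      ¬ cs.IsRightDescent v i ∧ ¬ cs.IsRightDescent v j := by
  suffices h : ∀ (n : ℕ) (v : W) (k : ℕ), cs.length v = n →
      w = v * cs.wordProd (alternatingWord i j (k + 1)) → cs.length w = cs.length v + (k + 1) →
      ∃ (v : W) (k : ℕ), w = v * cs.wordProd (alternatingWord i j (k + 1)) ∧
        cs.length w = cs.length v + (k + 1) ∧
        ¬ cs.IsRightDescent v i ∧ ¬ cs.IsRightDescent v j from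
    h _ (w * cs.simple j) 0 rfl (by simp [alternatingWord]) (cs.isRightDescent_iff.1 hj).symm
  intro n
  induction n using Nat.strong_induction_on with
  | _ n ih =>
  rintro v k rfl hw hlen
  by_cases hnext : cs.IsRightDescent v (if Even (k + 1) then j else i)
  · refine ih _ hnext _ (k + 1) rfl (eq_mul_wordProd_alternatingWord_succ hw) ?_
    rw [isRightDescent_iff] at hnext
    lia
  · have hprev := not_isRightDescent_of_length_eq_add_succ hw hlen
    refine ⟨v, k, hw, hlen, ?_⟩
    by_cases hk : Even k <;> simp_all [Nat.even_add_one]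

theorem eq_zero_or_lt_of_not_isRightDescent {v w : W} {i j : B} {k : ℕ}
    (hw : w = v * cs.wordProd (alternatingWord i j k)) (hlen : cs.length w = cs.length v + k)
    (hi : ¬ cs.IsRightDescent w i) : M i j = 0 ∨ k < M i j := by
  by_contra! hM
  have hred : cs.length (cs.wordProd (alternatingWord i j k)) = k := by
    have hle := cs.length_mul_le v (cs.wordProd (alternatingWord i j k))
    have hle' := length_mul_wordProd_alternatingWord_le (cs := cs) 1 i j k
    rw [← hw] at hle
    rw [one_mul, length_one] at hle'
    lia
  have hk : k = M i j := by
    by_contra hne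
    refine cs.not_isReduced_alternatingWord i j hM.1 (m := k) (by lia) ?_
    rw [CoxeterSystem.IsReduced, hred, length_alternatingWord]
  have hbraid : cs.wordProd (alternatingWord i j k) = cs.wordProd (alternatingWord j i k) := by
    have := cs.wordProd_braidWord_eq i j
    rwa [braidWord, braidWord, M.symmetric j i, ← hk] at this
  obtain ⟨k, rfl⟩ := Nat.exists_eq_succ_of_ne_zero (hk.trans_ne hM.1)
  have hwi : w * cs.simple i = v * cs.wordProd (alternatingWord i j k) := by
    rw [hw, hbraid, alternatingWord_succ, wordProd_concat, ← mul_assoc,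
      simple_mul_simple_cancel_right]
  have hle := length_mul_wordProd_alternatingWord_le (cs := cs) v i j k
  rw [← hwi] at hle
  exact hi (show _ < _ by lia)

end DihedralFactorization

section Positivity

variable {cs} {w : W} {i : B}

theorem geomRep_simpleRoot_nonneg_of_not_isRightDescent (h : ¬ cs.IsRightDescent w i) :
    0 ≤ geomRep cs w (simpleRoot i) := by
  induction hn : cs.length w using Nat.strong_induction_on generalizing w i with
  | _ n ih =>
  subst hn
  rcases eq_or_ne w 1 with rfl | hw
  · simpa using simpleRoot_nonneg i
  obtain ⟨j, hj⟩ := cs.exists_rightDescent_of_ne_one hw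
  have hij : i ≠ j := by rintro rfl; exact h hj
  obtain ⟨v, k, hwv, hlen, hvi, hvj⟩ := exists_eq_mul_wordProd_alternatingWord (i := i) hj
  have hM := eq_zero_or_lt_of_not_isRightDescent hwv hlen h
  replace hvi := ih _ (by lia) hvi rfl
  replace hvj := ih _ (by lia) hvj rfl
  have hM1 : M i j ≠ 1 := M.off_diagonal i j hij
  have hS := chebyshevS_eval_two_mul_cos_pi_div_nonneg hM1 (hM.imp_right le_of_lt)
  have hS' := chebyshevS_eval_two_mul_cos_pi_div_nonneg hM1 (hM.imp_right Nat.succ_le_of_lt)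
  rw [Nat.cast_succ, add_sub_cancel_right] at hS'
  rw [hwv, geomRep_mul_apply, geomRep_alternatingWord_simpleRoot]
  split_ifs <;> rw [map_add, map_smul, map_smul] <;>
    exact add_nonneg (smul_nonneg ‹_› hvi) (smul_nonneg ‹_› hvj)

theorem geomRep_simpleRoot_nonpos_of_isRightDescent (h : cs.IsRightDescent w i) :
    geomRep cs w (simpleRoot i) ≤ 0 := by
  have := geomRep_simpleRoot_nonneg_of_not_isRightDescent
    (cs.isRightDescent_iff_not_isRightDescent_mul.1 h)
  rwa [geomRep_mul_apply, geomRep_simple_simpleRoot, map_neg, Left.nonneg_neg_iff] at this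

theorem isRightDescent_iff_geomRep_nonpos :
    cs.IsRightDescent w i ↔ geomRep cs w (simpleRoot i) ≤ 0 := by
  refine ⟨geomRep_simpleRoot_nonpos_of_isRightDescent, fun h => ?_⟩
  by_contra hd
  exact geomRep_simpleRoot_ne_zero cs w i
    (le_antisymm h (geomRep_simpleRoot_nonneg_of_not_isRightDescent hd))

theorem not_isRightDescent_iff_geomRep_nonneg :
    ¬ cs.IsRightDescent w i ↔ 0 ≤ geomRep cs w (simpleRoot i) := by
  refine ⟨geomRep_simpleRoot_nonneg_of_not_isRightDescent, fun h hd => ?_⟩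
  exact geomRep_simpleRoot_ne_zero cs w i
    (le_antisymm (geomRep_simpleRoot_nonpos_of_isRightDescent hd) h)

theorem isLeftDescent_iff_geomRep_inv_nonpos :
    cs.IsLeftDescent w i ↔ geomRep cs w⁻¹ (simpleRoot i) ≤ 0 := by
  rw [← isRightDescent_iff_geomRep_nonpos, isRightDescent_inv_iff]

theorem not_isLeftDescent_iff_geomRep_inv_nonneg :
    ¬ cs.IsLeftDescent w i ↔ 0 ≤ geomRep cs w⁻¹ (simpleRoot i) := by
  rw [← not_isRightDescent_iff_geomRep_nonneg, isRightDescent_inv_iff]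

theorem geomRep_simpleRoot_nonneg_or_nonpos (w : W) (i : B) :
    0 ≤ geomRep cs w (simpleRoot i) ∨ geomRep cs w (simpleRoot i) ≤ 0 := by
  rw [← isRightDescent_iff_geomRep_nonpos, ← not_isRightDescent_iff_geomRep_nonneg]
  exact (em _).symm

theorem eq_one_of_forall_geomRep_simpleRoot_nonneg
    (h : ∀ i, 0 ≤ geomRep cs w (simpleRoot i)) : w = 1 := by
  by_contra hw
  obtain ⟨i, hi⟩ := cs.exists_rightDescent_of_ne_one hw
  exact not_isRightDescent_iff_geomRep_nonneg.2 (h i) hi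

theorem geomRep_injective : Function.Injective (geomRep cs) := by
  rw [injective_iff_map_eq_one]
  intro w hw
  refine eq_one_of_forall_geomRep_simpleRoot_nonneg (cs := cs) fun i => ?_
  rw [hw]
  exact simpleRoot_nonneg i

end Positivity

end CoxeterInvolution

namespace CoxeterInvolution

open CoxeterSystem

variable {B W : Type*} [Group W] {M : CoxeterMatrix B} {cs : CoxeterSystem M W}

/-! ### Parabolic subgroups and the spans of their roots -/

section Parabolic

theorem simple_mem_standardParabolic {I : Set B} {i : B} (hi : i ∈ I) :
    cs.simple i ∈ cs.standardParabolic I :=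
  Subgroup.subset_closure ⟨i, hi, rfl⟩

theorem mem_conjParabolic {g x : W} {I : Set B} :
    x ∈ cs.conjParabolic g I ↔ g⁻¹ * x * g ∈ cs.standardParabolic I := by
  rw [conjParabolic, Subgroup.mem_map_equiv, MulAut.conj_symm_apply]

theorem conj_mem_conjParabolic_mul {g x w : W} {I : Set B} :
    x * w * x⁻¹ ∈ cs.conjParabolic (x * g) I ↔ w ∈ cs.conjParabolic g I := by
  rw [mem_conjParabolic, mem_conjParabolic]
  group

theorem conjParabolic_one (I : Set B) : cs.conjParabolic 1 I = cs.standardParabolic I := by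
  ext x
  simp [mem_conjParabolic]

theorem conjParabolic_le_iff {g : W} {I : Set B} {H : Subgroup W} :
    cs.conjParabolic g I ≤ H ↔ ∀ i ∈ I, g * cs.simple i * g⁻¹ ∈ H := by
  rw [conjParabolic, standardParabolic, Subgroup.map_le_iff_le_comap, Subgroup.closure_le,
    Set.image_subset_iff]
  rfl

variable (cs) in
/-- The span of the roots `g αᵢ`, `i ∈ I`, of the parabolic subgroup `g W_I g⁻¹`. -/
noncomputable def rootSpan (g : W) (I : Set B) : Submodule ℝ (B →₀ ℝ) :=
  (Finsupp.supported ℝ ℝ I).map (geomRep cs g).toLinearMap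

theorem mem_rootSpan {g : W} {I : Set B} {v : B →₀ ℝ} :
    v ∈ rootSpan cs g I ↔ geomRep cs g⁻¹ v ∈ Finsupp.supported ℝ ℝ I := by
  refine ⟨?_, fun h => ⟨_, h, geomRep_apply_inv_apply cs g v⟩⟩
  rintro ⟨v, hv, rfl⟩
  simpa using hv

theorem simpleRoot_mem_supported {I : Set B} {i : B} (hi : i ∈ I) :
    simpleRoot i ∈ Finsupp.supported ℝ ℝ I :=
  Finsupp.single_mem_supported ℝ 1 hi

theorem geomRep_simpleRoot_mem_rootSpan {g : W} {I : Set B} {i : B} (hi : i ∈ I) :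
    geomRep cs g (simpleRoot i) ∈ rootSpan cs g I :=
  Submodule.mem_map_of_mem (simpleRoot_mem_supported hi)

theorem rootSpan_eq_span (g : W) (I : Set B) :
    rootSpan cs g I = Submodule.span ℝ ((fun i => geomRep cs g (simpleRoot i)) '' I) := by
  rw [rootSpan, Finsupp.supported_eq_span_single, Submodule.map_span, Set.image_image]
  rfl

theorem rootSpan_eqOn {V : Type*} [AddCommGroup V] [Module ℝ V] {f f' : (B →₀ ℝ) →ₗ[ℝ] V}
    {g : W} {I : Set B}
    (h : ∀ i ∈ I, f (geomRep cs g (simpleRoot i)) = f' (geomRep cs g (simpleRoot i))) :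
    Set.EqOn f f' (rootSpan cs g I) := by
  rw [rootSpan_eq_span]
  exact LinearMap.eqOn_span' (Set.forall_mem_image.2 h)

theorem geomRep_sub_mem_supported {I : Set B} {w : W} (hw : w ∈ cs.standardParabolic I)
    (v : B →₀ ℝ) : geomRep cs w v - v ∈ Finsupp.supported ℝ ℝ I := by
  induction hw using Subgroup.closure_induction generalizing v with
  | mem x hx =>
    obtain ⟨i, hi, rfl⟩ := hx
    rw [geomRep_simple, sub_sub_cancel_left]
    exact neg_mem (Submodule.smul_mem _ _ (simpleRoot_mem_supported hi))
  | one => simp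
  | mul x y _ _ hx hy =>
    rw [geomRep_mul_apply, ← sub_add_sub_cancel _ (geomRep cs y v)]
    exact add_mem (hx _) (hy _)
  | inv x _ hx =>
    have := neg_mem (hx (geomRep cs x⁻¹ v))
    rwa [geomRep_apply_inv_apply, neg_sub] at this

theorem geomRep_mem_supported {I : Set B} {w : W} (hw : w ∈ cs.standardParabolic I)
    {v : B →₀ ℝ} (hv : v ∈ Finsupp.supported ℝ ℝ I) :
    geomRep cs w v ∈ Finsupp.supported ℝ ℝ I := by
  have := add_mem (geomRep_sub_mem_supported hw v) hv
  rwa [sub_add_cancel] at this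

theorem geomRep_sub_mem_rootSpan {g w : W} {I : Set B} (hw : w ∈ cs.conjParabolic g I)
    (v : B →₀ ℝ) : geomRep cs w v - v ∈ rootSpan cs g I := by
  have := geomRep_sub_mem_supported (mem_conjParabolic.1 hw) (geomRep cs g⁻¹ v)
  rwa [mul_assoc, geomRep_mul_apply, geomRep_mul_apply, geomRep_apply_inv_apply, ← map_sub,
    ← mem_rootSpan] at this

theorem mem_of_isRightDescent {I : Set B} {w : W} (hw : w ∈ cs.standardParabolic I) {i : B}
    (hi : cs.IsRightDescent w i) : i ∈ I := by
  by_contra hiI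
  have h₁ := (Finsupp.mem_supported' _ _).1 (geomRep_sub_mem_supported hw (simpleRoot i)) i hiI
  have h₂ : geomRep cs w (simpleRoot i) i ≤ 0 := isRightDescent_iff_geomRep_nonpos.1 hi i
  rw [Finsupp.sub_apply, sub_eq_zero] at h₁
  rw [h₁, simpleRoot, Finsupp.single_eq_same] at h₂
  exact absurd h₂ (by norm_num)

theorem eq_one_of_mem_standardParabolic {I : Set B} {w : W} (hw : w ∈ cs.standardParabolic I)
    (h : ∀ i ∈ I, 0 ≤ geomRep cs w (simpleRoot i)) : w = 1 := by
  by_contra h1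
  obtain ⟨i, hi⟩ := cs.exists_rightDescent_of_ne_one h1
  exact not_isRightDescent_iff_geomRep_nonneg.2 (h i (mem_of_isRightDescent hw hi)) hi

end Parabolic

section RootsInSpans

theorem mul_self_eq_one_of_geomRep_eq_smul {x y : W} {i j : B} {c : ℝ}
    (h : geomRep cs x (simpleRoot i) = c • geomRep cs y (simpleRoot j)) : c * c = 1 := by
  have hform := rootForm_geomRep cs x (simpleRoot i) (simpleRoot i)
  rw [h] at hform
  simpa [rootForm_geomRep, rootForm_simpleRoot_self] using hform

theorem conj_simple_eq_of_geomRep_eq_smul {x y : W} {i j : B} {c : ℝ}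
    (h : geomRep cs x (simpleRoot i) = c • geomRep cs y (simpleRoot j)) :
    x * cs.simple i * x⁻¹ = y * cs.simple j * y⁻¹ := by
  apply geomRep_injective (cs := cs)
  ext1 v
  rw [geomRep_conj_simple, geomRep_conj_simple, h]
  simp only [map_smul, LinearMap.smul_apply, smul_eq_mul, smul_smul]
  congr 2
  linear_combination (2 * rootForm M (geomRep cs y (simpleRoot j)) v) *
    mul_self_eq_one_of_geomRep_eq_smul h

theorem commute_conj_simple_of_geomRep_eq_smul {u x : W} {i : B} {c : ℝ}
    (h : geomRep cs u (geomRep cs x (simpleRoot i)) = c • geomRep cs x (simpleRoot i)) :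
    Commute u (x * cs.simple i * x⁻¹) := by
  rw [← geomRep_mul_apply] at h
  have hconj := conj_simple_eq_of_geomRep_eq_smul h
  exact mul_inv_eq_iff_eq_mul.1 (by simpa only [mul_inv_rev, mul_assoc] using hconj)

theorem eq_smul_simpleRoot_of_nonneg_of_le {v : B →₀ ℝ} {i : B} {c : ℝ} (hv : 0 ≤ v)
    (hle : v ≤ c • simpleRoot i) : v = v i • simpleRoot i := by
  ext k
  rcases eq_or_ne k i with rfl | hk
  · simp [simpleRoot]
  · have hzero : simpleRoot i k = 0 := Finsupp.single_eq_of_ne hk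
    have hle := hle k
    rw [Finsupp.smul_apply, hzero, smul_zero] at hle ⊢
    exact le_antisymm hle (hv k)

theorem geomRep_nonneg_of_mem_supported {w : W} {J : Set B}
    (h : ∀ j ∈ J, 0 ≤ geomRep cs w (simpleRoot j)) {v : B →₀ ℝ}
    (hv : v ∈ Finsupp.supported ℝ ℝ J) (hv0 : 0 ≤ v) : 0 ≤ geomRep cs w v := by
  have hsum : v = ∑ j ∈ v.support, v j • simpleRoot j := by
    conv_lhs => rw [← Finsupp.sum_single v]
    simp [Finsupp.sum, simpleRoot]
  rw [hsum, map_sum]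
  simp only [map_smul]
  exact Finset.sum_nonneg fun j hj => smul_nonneg (hv0 j) (h j (hv hj))

theorem exists_conj_simple_eq_simple {J : Set B} {y : W} {i : B}
    (hy : geomRep cs y (simpleRoot i) ∈ Finsupp.supported ℝ ℝ J)
    (hmin : ∀ j ∈ J, ¬ cs.IsLeftDescent y j) :
    ∃ j ∈ J, y * cs.simple i * y⁻¹ = cs.simple j := by
  set β := geomRep cs y (simpleRoot i) with hβ
  have hpos : ∀ v ∈ Finsupp.supported ℝ ℝ J, 0 ≤ v → 0 ≤ geomRep cs y⁻¹ v := fun v =>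
    geomRep_nonneg_of_mem_supported fun j hj =>
      not_isLeftDescent_iff_geomRep_inv_nonneg.1 (hmin j hj)
  have hβ0 : 0 ≤ β := by
    refine (geomRep_simpleRoot_nonneg_or_nonpos y i).resolve_right fun hneg => ?_
    have := hpos (-β) (neg_mem hy) (neg_nonneg.2 hneg)
    rw [map_neg, hβ, geomRep_inv_apply_apply, neg_nonneg] at this
    exact simpleRoot_ne_zero i (le_antisymm this (simpleRoot_nonneg i))
  obtain ⟨j, hj⟩ : β.support.Nonempty :=
    Finsupp.support_nonempty_iff.2 (geomRep_simpleRoot_ne_zero cs y i)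
  have hβj : 0 < β j := (hβ0 j).lt_of_ne' (Finsupp.mem_support_iff.1 hj)
  have hle : geomRep cs y⁻¹ (simpleRoot j) ≤ (β j)⁻¹ • simpleRoot i := by
    have hmem : β - β j • simpleRoot j ∈ Finsupp.supported ℝ ℝ J :=
      sub_mem hy (Submodule.smul_mem _ _ (simpleRoot_mem_supported (hy hj)))
    have hnn : 0 ≤ β - β j • simpleRoot j := by
      rw [sub_nonneg]
      intro k
      rcases eq_or_ne k j with rfl | hk
      · simp [simpleRoot]
      · simpa [simpleRoot, Finsupp.single_eq_of_ne hk] using hβ0 k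
    have := hpos _ hmem hnn
    rwa [map_sub, map_smul, hβ, geomRep_inv_apply_apply, ← hβ, sub_nonneg,
      ← le_inv_smul_iff_of_pos hβj] at this
  have hmul := eq_smul_simpleRoot_of_nonneg_of_le
    (not_isLeftDescent_iff_geomRep_inv_nonneg.1 (hmin j (hy hj))) hle
  have hrefl := conj_simple_eq_of_geomRep_eq_smul (cs := cs) (y := 1)
    (hmul.trans (by rw [geomRep_one_apply]))
  refine ⟨j, hy hj, ?_⟩
  rw [one_mul, inv_one, mul_one, inv_inv] at hrefl
  rw [← hrefl]
  group

theorem conj_simple_mem_standardParabolic {J : Set B} {x : W} {i : B}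
    (h : geomRep cs x (simpleRoot i) ∈ Finsupp.supported ℝ ℝ J) :
    x * cs.simple i * x⁻¹ ∈ cs.standardParabolic J := by
  obtain ⟨z, hz, hmin⟩ := exists_minimalFor_of_wellFoundedLT (· ∈ cs.standardParabolic J)
    (fun z => cs.length (z * x)) ⟨1, one_mem _⟩
  obtain ⟨j, hj, hconj⟩ := exists_conj_simple_eq_simple (cs := cs) (y := z * x) (i := i) (J := J)
    (by rw [geomRep_mul_apply]; exact geomRep_mem_supported hz h) fun j hj hd => by
      have hzj := mul_mem (simple_mem_standardParabolic (cs := cs) hj) hz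
      rw [IsLeftDescent, ← mul_assoc] at hd
      exact hd.not_ge (hmin hzj hd.le)
  have : x * cs.simple i * x⁻¹ = z⁻¹ * cs.simple j * z := by
    rw [← hconj]
    group
  rw [this]
  exact mul_mem (mul_mem (inv_mem hz) (simple_mem_standardParabolic hj)) hz

theorem conj_simple_mem_conjParabolic {g x : W} {J : Set B} {i : B}
    (h : geomRep cs x (simpleRoot i) ∈ rootSpan cs g J) :
    x * cs.simple i * x⁻¹ ∈ cs.conjParabolic g J := by
  rw [mem_rootSpan, ← geomRep_mul_apply] at h
  rw [mem_conjParabolic]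
  convert conj_simple_mem_standardParabolic h using 1
  group

end RootsInSpans

/-! ### Richardson's theorem and the parabolic closure of an involution -/

section Finiteness

theorem exists_reduced_word_of_mem_standardParabolic {I : Set B} {w : W}
    (hw : w ∈ cs.standardParabolic I) :
    ∃ ω : List I, ω.length = cs.length w ∧ cs.wordProd (ω.map (↑)) = w := by
  induction hn : cs.length w generalizing w with
  | zero => exact ⟨[], rfl, by simp [cs.length_eq_zero_iff.1 hn]⟩
  | succ n ih =>
    have h1 : w ≠ 1 := by
      rintro rfl
      simp at hn
    obtain ⟨i, hi⟩ := cs.exists_rightDescent_of_ne_one h1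
    have hiI := mem_of_isRightDescent hw hi
    obtain ⟨ω, hω, hω'⟩ := ih (mul_mem hw (simple_mem_standardParabolic hiI)) (by
      rw [isRightDescent_iff] at hi
      lia)
    refine ⟨ω.concat ⟨i, hiI⟩, by simp [hω], ?_⟩
    rw [List.concat_eq_append, List.map_append, wordProd_append, hω']
    simp

theorem finite_standardParabolic_of_length_le {I : Set B} (hI : I.Finite) {n : ℕ}
    (h : ∀ w ∈ cs.standardParabolic I, cs.length w ≤ n) : Finite (cs.standardParabolic I) := by
  have := hI.to_subtype
  have hfin : ((fun ω : List I => cs.wordProd (ω.map (↑))) '' {ω | ω.length ≤ n}).Finite :=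
    (List.finite_length_le I n).image _
  refine (hfin.subset fun w hw => ?_).to_subtype
  obtain ⟨ω, hω, rfl⟩ := exists_reduced_word_of_mem_standardParabolic hw
  exact ⟨ω, hω.trans_le (h _ hw), rfl⟩

theorem finite_setOf_isRightDescent (w : W) : {i | cs.IsRightDescent w i}.Finite := by
  obtain ⟨ω, rfl⟩ := cs.wordProd_surjective w
  have hω : cs.wordProd ω ∈ cs.standardParabolic {i | i ∈ ω} :=
    list_prod_mem fun x hx => by
      obtain ⟨i, hi, rfl⟩ := List.mem_map.1 hx
      exact simple_mem_standardParabolic hi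
  exact (List.finite_toSet ω).subset fun i hi => mem_of_isRightDescent hω hi

end Finiteness

variable (cs) in
/-- `u` acts as `-1` on the roots `g αᵢ`, `i ∈ I`. For `g = 1` these are the simple roots of
`W_I`. -/
def NegatesRoots (u g : W) (I : Set B) : Prop :=
  ∀ i ∈ I, geomRep cs u (geomRep cs g (simpleRoot i)) = -geomRep cs g (simpleRoot i)

namespace NegatesRoots

variable {u g x : W} {I : Set B}

theorem geomRep_eq_neg (h : NegatesRoots cs u g I) {v : B →₀ ℝ} (hv : v ∈ rootSpan cs g I) :
    geomRep cs u v = -v :=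
  rootSpan_eqOn (f := (geomRep cs u).toLinearMap) (f' := -LinearMap.id) (fun i hi => h i hi) hv

theorem conj (h : NegatesRoots cs u g I) : NegatesRoots cs (x * u * x⁻¹) (x * g) I := by
  intro i hi
  rw [geomRep_mul_apply, geomRep_mul_apply, geomRep_mul_apply, geomRep_inv_apply_apply, h i hi,
    map_neg]

theorem isRightDescent_mul_iff (h : NegatesRoots cs u 1 I) (hx : x ∈ cs.standardParabolic I)
    {i : B} (hi : i ∈ I) : cs.IsRightDescent (u * x) i ↔ ¬ cs.IsRightDescent x i := by
  have hxi : geomRep cs x (simpleRoot i) ∈ rootSpan cs 1 I := by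
    rw [mem_rootSpan, inv_one, geomRep_one_apply]
    exact geomRep_mem_supported hx (simpleRoot_mem_supported hi)
  rw [isRightDescent_iff_geomRep_nonpos, geomRep_mul_apply, h.geomRep_eq_neg hxi,
    Left.neg_nonpos_iff, not_isRightDescent_iff_geomRep_nonneg]

theorem length_mul_add_length (h : NegatesRoots cs u 1 I) (hx : x ∈ cs.standardParabolic I) :
    cs.length (u * x) + cs.length x = cs.length u := by
  have hstep : ∀ x ∈ cs.standardParabolic I, ∀ i ∈ I,
      cs.length (u * x) + cs.length x = cs.length u →
      cs.length (u * (x * cs.simple i)) + cs.length (x * cs.simple i) = cs.length u := by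
    intro x hx i hi ih
    rw [← mul_assoc]
    have hdesc := h.isRightDescent_mul_iff hx hi
    by_cases hd : cs.IsRightDescent x i
    · have hd' := mt hdesc.1 (not_not.2 hd)
      rw [isRightDescent_iff] at hd
      rw [not_isRightDescent_iff] at hd'
      lia
    · have hd' := hdesc.2 hd
      rw [not_isRightDescent_iff] at hd
      rw [isRightDescent_iff] at hd'
      lia
  induction hx using Subgroup.closure_induction_right with
  | one => simp
  | mul_right x hx s hs ih =>
    obtain ⟨i, hi, rfl⟩ := hs
    exact hstep x hx i hi ih
  | mul_inv_cancel x hx s hs ih =>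
    obtain ⟨i, hi, rfl⟩ := hs
    rw [inv_simple]
    exact hstep x hx i hi ih

/-- Take `x ∈ W_I` with `u x` as short as possible; a left descent `j` of `u x` would be a descent
of `u`, hence in `I`, and then `u sⱼ x` would be even shorter. -/
theorem mem_standardParabolic (hu : u⁻¹ = u)
    (h : NegatesRoots cs u 1 {i | cs.IsRightDescent u i}) :
    u ∈ cs.standardParabolic {i | cs.IsRightDescent u i} := by
  set I := {i | cs.IsRightDescent u i}
  obtain ⟨x, hx, hmin⟩ := exists_minimalFor_of_wellFoundedLT (· ∈ cs.standardParabolic I)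
    (fun x => cs.length (u * x)) ⟨1, one_mem _⟩
  suffices hux : u * x = 1 by
    rw [eq_inv_of_mul_eq_one_left hux]
    exact inv_mem hx
  by_contra hux
  obtain ⟨j, hj⟩ := cs.exists_leftDescent_of_ne_one hux
  have hlen := h.length_mul_add_length hx
  have hjI : j ∈ I := by
    have hle := cs.length_mul_le (cs.simple j * (u * x)) x⁻¹
    rw [show cs.simple j * (u * x) * x⁻¹ = cs.simple j * u by group, length_inv] at hle
    change cs.IsRightDescent u j
    rw [← hu, isRightDescent_inv_iff, IsLeftDescent]
    rw [IsLeftDescent] at hj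
    lia
  have hjx : ¬ cs.IsLeftDescent x j := by
    have huj := h j hjI
    rw [geomRep_one_apply] at huj
    rw [isLeftDescent_iff_geomRep_inv_nonpos, mul_inv_rev, hu, geomRep_mul_apply, huj, map_neg,
      Left.neg_nonpos_iff] at hj
    exact not_isLeftDescent_iff_geomRep_inv_nonneg.2 hj
  have hjxI := mul_mem (simple_mem_standardParabolic hjI) hx
  have hlen' := h.length_mul_add_length hjxI
  have hle : cs.length (u * x) ≤ cs.length (u * (cs.simple j * x)) := by
    by_contra! hlt
    exact hlt.not_ge (hmin hjxI hlt.le)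
  rw [not_isLeftDescent_iff] at hjx
  lia

theorem rootSpan_le_of_mem_conjParabolic (h : NegatesRoots cs u g I) {J : Set B}
    (hu : u ∈ cs.conjParabolic x J) : rootSpan cs g I ≤ rootSpan cs x J := by
  intro v hv
  have hmem := Submodule.smul_mem _ (-1 / 2 : ℝ) (geomRep_sub_mem_rootSpan hu v)
  rw [h.geomRep_eq_neg hv] at hmem
  convert hmem using 1
  module

theorem parabolicClosure_eq (h : NegatesRoots cs u g I) (hu : u ∈ cs.conjParabolic g I) :
    cs.parabolicClosure u = cs.conjParabolic g I := by
  refine le_antisymm (sInf_le ⟨⟨g, I, rfl⟩, hu⟩) (le_sInf ?_)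
  rintro _ ⟨⟨x, J, rfl⟩, hx⟩
  rw [conjParabolic_le_iff]
  exact fun i hi => conj_simple_mem_conjParabolic <|
    h.rootSpan_le_of_mem_conjParabolic hx (geomRep_simpleRoot_mem_rootSpan hi)

end NegatesRoots

theorem mem_parabolicClosure (w : W) : w ∈ cs.parabolicClosure w :=
  Subgroup.mem_sInf.2 fun _ h => h.2

theorem geomRep_simpleRoot_eq_neg_of_length_le {u : W} (hu : u⁻¹ = u) {i : B}
    (hi : cs.IsRightDescent u i)
    (hle : cs.length u ≤ cs.length (cs.simple i * u * cs.simple i)) :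
    geomRep cs u (simpleRoot i) = -simpleRoot i := by
  have hneg := isRightDescent_iff_geomRep_nonpos.1 hi
  have hd : ¬ cs.IsLeftDescent (u * cs.simple i) i := by
    rw [IsLeftDescent, ← mul_assoc]
    rw [isRightDescent_iff] at hi
    lia
  rw [not_isLeftDescent_iff_geomRep_inv_nonneg, mul_inv_rev, inv_simple, hu, geomRep_mul_apply,
    geomRep_simple, sub_nonneg, ← neg_le_neg_iff, ← neg_smul] at hd
  obtain ⟨c, hc⟩ : ∃ c : ℝ, geomRep cs u (simpleRoot i) = c • simpleRoot i :=
    ⟨_, by rw [neg_smul, ← eq_smul_simpleRoot_of_nonneg_of_le (neg_nonneg.2 hneg) hd, neg_neg]⟩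
  have hcc := mul_self_eq_one_of_geomRep_eq_smul (cs := cs) (y := 1)
    (hc.trans (by rw [geomRep_one_apply]))
  have hc0 : c ≤ 0 := by
    have hi := hneg i
    rw [hc] at hi
    simpa [simpleRoot] using hi
  rw [hc, show c = -1 by nlinarith, neg_one_smul]

/-- **Richardson's theorem**: conjugating by right descents whose roots are not negated shortens
the involution until it acts as `-1` on the roots of a finite parabolic subgroup. -/
theorem exists_negatesRoots {u : W} (hu : u ^ 2 = 1) :
    ∃ (g : W) (I : Set B), I.Finite ∧ Finite (cs.standardParabolic I) ∧
      u ∈ cs.conjParabolic g I ∧ NegatesRoots cs u g I := by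
  induction hn : cs.length u using Nat.strong_induction_on generalizing u with
  | _ n ih =>
  subst hn
  have hinv : u⁻¹ = u := inv_eq_of_mul_eq_one_right (by rw [← pow_two, hu])
  by_cases hI : NegatesRoots cs u 1 {i | cs.IsRightDescent u i}
  · have hfin := finite_setOf_isRightDescent (cs := cs) u
    refine ⟨1, _, hfin, finite_standardParabolic_of_length_le hfin fun x hx =>
      Nat.le.intro ((add_comm _ _).trans (hI.length_mul_add_length hx)), ?_, hI⟩
    rw [conjParabolic_one]
    exact hI.mem_standardParabolic hinv
  · simp only [NegatesRoots, not_forall, geomRep_one_apply] at hI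
    obtain ⟨i, hi, hne⟩ := hI
    have hlt := lt_of_not_ge (mt (geomRep_simpleRoot_eq_neg_of_length_le hinv hi) hne)
    have hu' : (cs.simple i * u * cs.simple i) ^ 2 = 1 := by
      calc _ = (cs.simple i * u * (cs.simple i)⁻¹) ^ 2 := by rw [inv_simple]
        _ = 1 := by rw [conj_pow, hu, mul_one, mul_inv_cancel]
    obtain ⟨g, I, hIfin, hfin, hmem, hneg⟩ := ih _ hlt hu' rfl
    have hconj : u = cs.simple i * (cs.simple i * u * cs.simple i) * (cs.simple i)⁻¹ := by
      simp [mul_assoc]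
    refine ⟨cs.simple i * g, I, hIfin, hfin, ?_, ?_⟩ <;> rw [hconj]
    · exact conj_mem_conjParabolic_mul.2 hmem
    · exact hneg.conj

theorem isLeast_parabolicClosure {u : W} (hu : u ^ 2 = 1) :
    IsLeast {P : Subgroup W | cs.IsParabolic P ∧ u ∈ P} (cs.parabolicClosure u) := by
  obtain ⟨g, I, -, -, hmem, hneg⟩ := exists_negatesRoots (cs := cs) hu
  exact ⟨⟨⟨g, I, hneg.parabolicClosure_eq hmem⟩, mem_parabolicClosure u⟩, fun _ h => sInf_le h⟩

theorem finite_parabolicClosure {u : W} (hu : u ^ 2 = 1) : Finite (cs.parabolicClosure u) := by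
  obtain ⟨g, I, -, hfin, hmem, hneg⟩ := exists_negatesRoots (cs := cs) hu
  rw [hneg.parabolicClosure_eq hmem]
  exact Set.Finite.image _ (Set.toFinite (cs.standardParabolic I : Set W))

/-! ### Shortest reflection factorizations of an involution -/

section MovedSpace

variable (cs) in
/-- The image of `w - 1` in the geometric representation; for an involution its dimension is the
reflection length. -/
noncomputable def movedSpace (w : W) : Submodule ℝ (B →₀ ℝ) :=
  LinearMap.range ((geomRep cs w).toLinearMap - LinearMap.id)

theorem geomRep_sub_mem_movedSpace (w : W) (v : B →₀ ℝ) :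
    geomRep cs w v - v ∈ movedSpace cs w :=
  ⟨v, rfl⟩

theorem movedSpace_le_iff {w : W} {U : Submodule ℝ (B →₀ ℝ)} :
    movedSpace cs w ≤ U ↔ ∀ v, geomRep cs w v - v ∈ U := by
  rw [movedSpace, LinearMap.range_le_iff_comap, Submodule.eq_top_iff']
  rfl

theorem movedSpace_one : movedSpace cs 1 = ⊥ :=
  eq_bot_iff.2 (movedSpace_le_iff.2 (by simp))

theorem movedSpace_mul_le (x y : W) :
    movedSpace cs (x * y) ≤ movedSpace cs x ⊔ movedSpace cs y := by
  rw [movedSpace_le_iff]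
  intro v
  rw [geomRep_mul_apply, ← sub_add_sub_cancel _ (geomRep cs y v)]
  exact add_mem (Submodule.mem_sup_left (geomRep_sub_mem_movedSpace x _))
    (Submodule.mem_sup_right (geomRep_sub_mem_movedSpace y v))

theorem mem_movedSpace_of_geomRep_eq_neg {w : W} {v : B →₀ ℝ} (h : geomRep cs w v = -v) :
    v ∈ movedSpace cs w := by
  have hmem := Submodule.smul_mem _ (-1 / 2 : ℝ) (geomRep_sub_mem_movedSpace (cs := cs) w v)
  rw [h] at hmem
  convert hmem using 1
  module

theorem geomRep_conj_simple_self (x : W) (i : B) :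
    geomRep cs (x * cs.simple i * x⁻¹) (geomRep cs x (simpleRoot i)) =
      -geomRep cs x (simpleRoot i) := by
  rw [geomRep_mul_apply, geomRep_inv_apply_apply, geomRep_mul_apply, geomRep_simple_simpleRoot,
    map_neg]

theorem movedSpace_conj_simple (x : W) (i : B) :
    movedSpace cs (x * cs.simple i * x⁻¹) =
      Submodule.span ℝ {geomRep cs x (simpleRoot i)} := by
  apply le_antisymm
  · rw [movedSpace_le_iff]
    intro v
    rw [geomRep_conj_simple, sub_sub_cancel_left]
    exact neg_mem (Submodule.smul_mem _ _ (Submodule.mem_span_singleton_self _))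
  · rw [Submodule.span_singleton_le_iff_mem]
    exact mem_movedSpace_of_geomRep_eq_neg (geomRep_conj_simple_self x i)

theorem NegatesRoots.movedSpace_eq {u g : W} {I : Set B} (h : NegatesRoots cs u g I)
    (hu : u ∈ cs.conjParabolic g I) : movedSpace cs u = rootSpan cs g I :=
  le_antisymm (movedSpace_le_iff.2 (geomRep_sub_mem_rootSpan hu)) fun _ hv =>
    mem_movedSpace_of_geomRep_eq_neg (h.geomRep_eq_neg hv)

theorem finiteDimensional_movedSpace {u : W} (hu : u ^ 2 = 1) :
    FiniteDimensional ℝ (movedSpace cs u) := by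
  obtain ⟨g, I, hI, -, hmem, hneg⟩ := exists_negatesRoots (cs := cs) hu
  rw [hneg.movedSpace_eq hmem, rootSpan_eq_span]
  exact FiniteDimensional.span_of_finite ℝ (hI.image _)

end MovedSpace

section Involution

variable {u : W}

theorem exists_geomRep_eq_neg_of_ne_one (hu : u ^ 2 = 1) (h1 : u ≠ 1) :
    ∃ x i, geomRep cs u (geomRep cs x (simpleRoot i)) = -geomRep cs x (simpleRoot i) := by
  obtain ⟨g, I, -, -, hmem, hneg⟩ := exists_negatesRoots (cs := cs) hu
  obtain rfl | ⟨i, hi⟩ := I.eq_empty_or_nonempty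
  · exact absurd (by simpa [conjParabolic, standardParabolic] using hmem) h1
  · exact ⟨g, i, hneg i hi⟩

variable {x : W} {i : B}
  (h : geomRep cs u (geomRep cs x (simpleRoot i)) = -geomRep cs x (simpleRoot i))

include h

theorem movedSpace_mul_conj_simple_lt :
    movedSpace cs (u * (x * cs.simple i * x⁻¹)) < movedSpace cs u := by
  set t := x * cs.simple i * x⁻¹ with ht
  set r := geomRep cs x (simpleRoot i)
  have hr : r ∈ movedSpace cs u := mem_movedSpace_of_geomRep_eq_neg h
  have hle : movedSpace cs (u * t) ≤ movedSpace cs u := by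
    refine (movedSpace_mul_le u t).trans (sup_le le_rfl ?_)
    rwa [ht, movedSpace_conj_simple, Submodule.span_singleton_le_iff_mem]
  have hfix : geomRep cs (u * t) r = r := by
    rw [geomRep_mul_apply, geomRep_conj_simple_self, map_neg, h, neg_neg]
  have horth : movedSpace cs (u * t) ≤ LinearMap.ker (rootForm M r) := by
    rw [movedSpace_le_iff]
    intro v
    rw [LinearMap.mem_ker, map_sub, sub_eq_zero, ← rootForm_geomRep cs (u * t) r v, hfix]
  refine lt_of_le_of_ne hle fun he => ?_
  rw [← he] at hr
  have hrr := LinearMap.mem_ker.1 (horth hr)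
  rw [rootForm_geomRep, rootForm_simpleRoot_self] at hrr
  exact one_ne_zero hrr

end Involution

theorem reflectionLength_le_finrank_movedSpace {u : W} (hu : u ^ 2 = 1) :
    cs.reflectionLength u ≤ Module.finrank ℝ (movedSpace cs u) := by
  induction hn : Module.finrank ℝ (movedSpace cs u) using Nat.strong_induction_on
    generalizing u with
  | _ n ih =>
  subst hn
  rcases eq_or_ne u 1 with rfl | h1
  · simp [reflectionLength_one]
  obtain ⟨x, i, hneg⟩ := exists_geomRep_eq_neg_of_ne_one (cs := cs) hu h1
  have ht : cs.IsReflection (x * cs.simple i * x⁻¹) := ⟨x, i, rfl⟩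
  have hcomm := commute_conj_simple_of_geomRep_eq_smul (hneg.trans (neg_one_smul ℝ _).symm)
  have hlt := movedSpace_mul_conj_simple_lt hneg
  set t := x * cs.simple i * x⁻¹
  have hsq : (u * t) ^ 2 = 1 := by rw [hcomm.mul_pow, hu, ht.pow_two, one_mul]
  have := finiteDimensional_movedSpace (cs := cs) hu
  have hle := ih _ (Submodule.finrank_lt_finrank_of_lt hlt) hsq rfl
  have hmul := cs.reflectionLength_mul_le (u * t) t
  have hone := cs.reflectionLength_prod_le [t] (by simpa using ht)
  rw [mul_assoc, ht.mul_self, mul_one] at hmul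
  rw [List.prod_singleton, List.length_singleton] at hone
  have := Submodule.finrank_lt_finrank_of_lt hlt
  lia

theorem movedSpace_prod_le_iSup (l : List W) :
    movedSpace cs l.prod ≤ ⨆ t ∈ l, movedSpace cs t := by
  induction l with
  | nil => simp [movedSpace_one]
  | cons t l ih =>
    simp only [List.prod_cons, List.mem_cons, iSup_or, iSup_sup_eq, iSup_iSup_eq_left]
    exact (movedSpace_mul_le t l.prod).trans (sup_le_sup_left ih _)

theorem finrank_iSup_movedSpace_le {l : List W} (hl : ∀ t ∈ l, cs.IsReflection t) :
    FiniteDimensional ℝ ↥(⨆ t ∈ l, movedSpace cs t) ∧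
      Module.finrank ℝ ↥(⨆ t ∈ l, movedSpace cs t) ≤ l.length := by
  induction l with
  | nil =>
    have hbot : (⨆ t ∈ ([] : List W), movedSpace cs t) = ⊥ := by simp
    rw [hbot]
    exact ⟨inferInstance, by simp⟩
  | cons t l ih =>
    obtain ⟨ht, hl⟩ := List.forall_mem_cons.1 hl
    obtain ⟨hfin, hle⟩ := ih hl
    obtain ⟨x, i, rfl⟩ := ht
    have hsup : (⨆ s ∈ x * cs.simple i * x⁻¹ :: l, movedSpace cs s) =
        Submodule.span ℝ {geomRep cs x (simpleRoot i)} ⊔ ⨆ s ∈ l, movedSpace cs s := by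
      simp only [List.mem_cons, iSup_or, iSup_sup_eq, iSup_iSup_eq_left, movedSpace_conj_simple]
    rw [hsup]
    refine ⟨inferInstance, (Submodule.finrank_add_le_finrank_add_finrank _ _).trans ?_⟩
    rw [finrank_span_singleton (geomRep_simpleRoot_ne_zero cs x i), List.length_cons, add_comm]
    gcongr

/-- The moved space of `u` lies in the sum of the lines moved by the letters of a shortest
factorization, and the dimensions force equality. -/
theorem mem_parabolicClosure_of_mem_reflectionWord {u : W} (hu : u ^ 2 = 1) {l : List W}
    (hl : ∀ t ∈ l, cs.IsReflection t) (hprod : l.prod = u)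
    (hlen : l.length = cs.reflectionLength u) {t : W} (ht : t ∈ l) :
    t ∈ cs.parabolicClosure u := by
  obtain ⟨hfin, hrank⟩ := finrank_iSup_movedSpace_le hl
  have hle := movedSpace_prod_le_iSup (cs := cs) l
  rw [hprod] at hle
  have heq := Submodule.eq_of_le_of_finrank_le hle <|
    (hrank.trans_eq hlen).trans (reflectionLength_le_finrank_movedSpace hu)
  have hmem : movedSpace cs t ≤ movedSpace cs u :=
    heq ▸ le_iSup₂ (f := fun t (_ : t ∈ l) => movedSpace cs t) t ht
  obtain ⟨g, I, -, -, hug, hneg⟩ := exists_negatesRoots (cs := cs) hu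
  obtain ⟨x, i, rfl⟩ := hl t ht
  rw [movedSpace_conj_simple, Submodule.span_singleton_le_iff_mem, hneg.movedSpace_eq hug] at hmem
  rw [hneg.parabolicClosure_eq hug]
  exact conj_simple_mem_conjParabolic hmem

/-! ### Direct products of parabolic subgroups -/

section Fixer

variable (cs) in
/-- The subgroup of elements fixing `v` in the geometric representation. -/
noncomputable def fixer (v : B →₀ ℝ) : Subgroup W :=
  (MulAction.stabilizer ((B →₀ ℝ) ≃ₗ[ℝ] (B →₀ ℝ)) v).comap (geomRep cs)

theorem mem_fixer {v : B →₀ ℝ} {w : W} : w ∈ fixer cs v ↔ geomRep cs w v = v :=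
  Iff.rfl

theorem conj_simple_mem_fixer {x : W} {i : B} {v : B →₀ ℝ}
    (h : rootForm M (geomRep cs x (simpleRoot i)) v = 0) :
    x * cs.simple i * x⁻¹ ∈ fixer cs v := by
  rw [mem_fixer, geomRep_conj_simple, h, mul_zero, zero_smul, sub_zero]

theorem eq_one_of_mem_conjParabolic {g x : W} {I : Set B} (hx : x ∈ cs.conjParabolic g I)
    (h : ∀ i ∈ I, x ∈ fixer cs (geomRep cs g (simpleRoot i))) : x = 1 := by
  have hone : g⁻¹ * x * g = 1 :=
    eq_one_of_mem_standardParabolic (mem_conjParabolic.1 hx) fun i hi => by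
      rw [mul_assoc, geomRep_mul_apply, geomRep_mul_apply, mem_fixer.1 (h i hi),
        geomRep_inv_apply_apply]
      exact simpleRoot_nonneg i
  rwa [mul_assoc, inv_mul_eq_one, right_eq_mul] at hone

theorem eq_of_mem_conjParabolic {g x y : W} {I : Set B} (hx : x ∈ cs.conjParabolic g I)
    (hy : y ∈ cs.conjParabolic g I)
    (h : ∀ i ∈ I, geomRep cs x (geomRep cs g (simpleRoot i)) =
      geomRep cs y (geomRep cs g (simpleRoot i))) : x = y := by
  refine inv_mul_eq_one.1 (eq_one_of_mem_conjParabolic (mul_mem (inv_mem hx) hy) fun i hi => ?_)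
  rw [mem_fixer, geomRep_mul_apply, ← h i hi, geomRep_inv_apply_apply]

end Fixer

theorem conj_simple_mem_conjParabolic_of_mem {g : W} {I : Set B} {i : B} (hi : i ∈ I) :
    g * cs.simple i * g⁻¹ ∈ cs.conjParabolic g I :=
  conjParabolic_le_iff.1 le_rfl i hi

theorem conjParabolic_mono (g : W) {I J : Set B} (h : I ⊆ J) :
    cs.conjParabolic g I ≤ cs.conjParabolic g J :=
  conjParabolic_le_iff.2 fun _ hi => conj_simple_mem_conjParabolic_of_mem (h hi)

section OrthogonalTypes

variable {I J : Set B} (hIJ : ∀ i ∈ I, ∀ j ∈ J, M i j = 2)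

include hIJ

theorem conjParabolic_le_fixer (g : W) {j : B} (hj : j ∈ J) :
    cs.conjParabolic g I ≤ fixer cs (geomRep cs g (simpleRoot j)) := by
  refine conjParabolic_le_iff.2 fun i hi => conj_simple_mem_fixer ?_
  rw [rootForm_geomRep, rootForm_simpleRoot_eq_zero_iff]
  exact hIJ i hi j hj

theorem commute_of_mem_conjParabolic {g x y : W} (hx : x ∈ cs.conjParabolic g I)
    (hy : y ∈ cs.conjParabolic g J) : Commute x y := by
  have hle : cs.conjParabolic g J ≤ Subgroup.centralizer {x} :=
    conjParabolic_le_iff.2 fun j hj => by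
      have hfix := mem_fixer.1 (conjParabolic_le_fixer hIJ g hj hx)
      exact Subgroup.mem_centralizer_singleton_iff.2
        (commute_conj_simple_of_geomRep_eq_smul (hfix.trans (one_smul ℝ _).symm)).eq.symm
  exact (Subgroup.mem_centralizer_singleton_iff.1 (hle hy)).symm

end OrthogonalTypes

theorem isInternalDirectProduct_conjParabolic {ι : Type*} [Fintype ι] (g : W) {J : ι → Set B}
    (hJ : Pairwise fun a b => ∀ i ∈ J a, ∀ j ∈ J b, M i j = 2) :
    Subgroup.IsInternalDirectProduct (fun a => cs.conjParabolic g (J a))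
      (cs.conjParabolic g (⋃ a, J a)) := by
  have hcomm : Pairwise fun a b => ∀ x y : W, x ∈ cs.conjParabolic g (J a) →
      y ∈ cs.conjParabolic g (J b) → Commute x y :=
    fun a b hab x y hx hy => commute_of_mem_conjParabolic (hJ hab) hx hy
  refine ⟨hcomm, Subgroup.injective_noncommPiCoprod_of_iSupIndep fun a => ?_, ?_⟩
  · refine Subgroup.disjoint_def.2 fun hx hx' => eq_one_of_mem_conjParabolic hx fun j hj => ?_
    exact iSup₂_le (fun b hb => conjParabolic_le_fixer (hJ hb) g hj) hx'
  · rw [Subgroup.noncommPiCoprod_range]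
    refine le_antisymm (iSup_le fun a => conjParabolic_mono g (Set.subset_iUnion J a)) ?_
    refine conjParabolic_le_iff.2 fun i hi => ?_
    obtain ⟨a, ha⟩ := Set.mem_iUnion.1 hi
    exact le_iSup (fun a => cs.conjParabolic g (J a)) a (conj_simple_mem_conjParabolic_of_mem ha)

theorem isReflection_ne_one {t : W} (ht : cs.IsReflection t) : t ≠ 1 := by
  rintro rfl
  simpa using ht.odd_length

theorem rootForm_eq_zero_of_commute {x y : W} {i j : B}
    (hc : Commute (x * cs.simple i * x⁻¹) (y * cs.simple j * y⁻¹))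
    (hne : x * cs.simple i * x⁻¹ ≠ y * cs.simple j * y⁻¹) :
    rootForm M (geomRep cs x (simpleRoot i)) (geomRep cs y (simpleRoot j)) = 0 := by
  by_contra hb
  have hmem : geomRep cs (x * cs.simple i * x⁻¹) (geomRep cs y (simpleRoot j)) ∈
      movedSpace cs (y * cs.simple j * y⁻¹) := by
    apply mem_movedSpace_of_geomRep_eq_neg
    rw [← geomRep_mul_apply, ← hc.eq, geomRep_mul_apply, geomRep_conj_simple_self, map_neg]
  have hy : geomRep cs y (simpleRoot j) ∈ movedSpace cs (y * cs.simple j * y⁻¹) :=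
    mem_movedSpace_of_geomRep_eq_neg (geomRep_conj_simple_self y j)
  rw [geomRep_conj_simple, Submodule.sub_mem_iff_right _ hy,
    Submodule.smul_mem_iff _ (mul_ne_zero two_ne_zero hb), movedSpace_conj_simple,
    Submodule.mem_span_singleton] at hmem
  obtain ⟨c, hc⟩ := hmem
  exact hne (conj_simple_eq_of_geomRep_eq_smul hc.symm)

section InternalDirectProduct

variable {ι : Type*} [Fintype ι] {H : ι → Subgroup W} {K : Subgroup W}
  (h : Subgroup.IsInternalDirectProduct H K)

include h

theorem rootForm_eq_zero_of_mem_of_mem {a b : ι} (hab : a ≠ b) {x y : W} {i j : B}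
    (hx : x * cs.simple i * x⁻¹ ∈ H a) (hy : y * cs.simple j * y⁻¹ ∈ H b) :
    rootForm M (geomRep cs x (simpleRoot i)) (geomRep cs y (simpleRoot j)) = 0 :=
  rootForm_eq_zero_of_commute (h.commute hab hx hy) fun he =>
    isReflection_ne_one ⟨x, i, rfl⟩ (h.eq_one_of_mem_of_mem hab hx (he ▸ hy))

variable (hH : ∀ a, cs.IsParabolic (H a))

include hH

theorem geomRep_mulEquiv_apply (f : ∀ a, H a) {a : ι} {g : W} {j : B}
    (hj : g * cs.simple j * g⁻¹ ∈ H a) :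
    geomRep cs (h.mulEquiv f) (geomRep cs g (simpleRoot j)) =
      geomRep cs (f a) (geomRep cs g (simpleRoot j)) := by
  have hfix : ∀ b ≠ a, H b ≤ fixer cs (geomRep cs g (simpleRoot j)) := by
    intro b hb
    obtain ⟨x, I, hx⟩ := hH b
    refine hx ▸ conjParabolic_le_iff.2 fun i hi => conj_simple_mem_fixer ?_
    exact rootForm_eq_zero_of_mem_of_mem h hb (hx ▸ conj_simple_mem_conjParabolic_of_mem hi) hj
  have hmem := mem_fixer.1 (h.inv_mul_mulEquiv_mem f hfix)
  rw [← congrArg (geomRep cs (f a)) hmem, geomRep_mul_apply, geomRep_apply_inv_apply]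

/-- If the component of `t` in `H a` is nontrivial, it moves a root of `H a`. The difference is a
nonzero multiple of the root of `t`, which therefore lies in the root span of `H a`. -/
theorem exists_mem_of_isReflection {t : W} (ht : cs.IsReflection t) (htK : t ∈ K) :
    ∃ a, t ∈ H a := by
  obtain ⟨f, hf⟩ := h.mulEquiv.surjective ⟨t, htK⟩
  replace hf : (h.mulEquiv f : W) = t := congrArg Subtype.val hf
  obtain ⟨a, ha⟩ : ∃ a, f a ≠ 1 := by
    by_contra! hall
    obtain rfl : f = 1 := funext hall
    exact isReflection_ne_one ht (by rw [← hf, map_one, Subgroup.coe_one])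
  obtain ⟨g, I, hg⟩ := hH a
  have hfa : (f a : W) ∈ cs.conjParabolic g I := hg ▸ (f a).2
  obtain ⟨j, hj, hmoved⟩ : ∃ j ∈ I, (f a : W) ∉ fixer cs (geomRep cs g (simpleRoot j)) := by
    by_contra! hfix
    exact ha (Subtype.ext (eq_one_of_mem_conjParabolic hfa hfix))
  have hdiff := geomRep_sub_mem_rootSpan hfa (geomRep cs g (simpleRoot j))
  have hft := geomRep_mulEquiv_apply h hH f (hg ▸ conj_simple_mem_conjParabolic_of_mem hj)
  obtain ⟨x, m, rfl⟩ := ht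
  rw [mem_fixer, ← hft, hf] at hmoved
  rw [← hft, hf, geomRep_conj_simple, sub_sub_cancel_left, neg_mem_iff, Submodule.smul_mem_iff]
    at hdiff
  · exact ⟨a, hg ▸ conj_simple_mem_conjParabolic hdiff⟩
  · exact mul_ne_zero two_ne_zero (mt (fun h0 => mem_fixer.1 (conj_simple_mem_fixer h0)) hmoved)

end InternalDirectProduct

/-! ### Connected components of the Coxeter graph -/

section Components

variable {I : Set B}

/-- The set of generators in a connected component of the Coxeter graph of `I`, as a subset of
`B`. -/
def componentType (c : (M.coxeterGraph.induce I).ConnectedComponent) : Set B :=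
  (↑) '' c.supp

theorem iUnion_componentType :
    ⋃ c : (M.coxeterGraph.induce I).ConnectedComponent, componentType c = I := by
  refine (Set.iUnion_subset fun _ => Subtype.coe_image_subset I _).antisymm fun i hi => ?_
  exact Set.mem_iUnion.2 ⟨SimpleGraph.connectedComponentMk _ ⟨i, hi⟩, ⟨i, hi⟩, rfl, rfl⟩

theorem eq_two_of_mem_componentType {c d : (M.coxeterGraph.induce I).ConnectedComponent}
    (hcd : c ≠ d) {i j : B} (hi : i ∈ componentType c) (hj : j ∈ componentType d) :
    M i j = 2 := by
  obtain ⟨i, rfl, rfl⟩ := hi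
  obtain ⟨j, rfl, rfl⟩ := hj
  by_contra hne
  have hij : (i : B) ≠ j := fun he => hcd (congrArg _ (Subtype.ext he))
  have hadj : (M.coxeterGraph.induce I).Adj i j := ⟨hij, hne⟩
  exact hcd (SimpleGraph.ConnectedComponent.connectedComponentMk_eq_of_adj hadj)

theorem connected_induce_componentType (c : (M.coxeterGraph.induce I).ConnectedComponent) :
    (M.coxeterGraph.induce (componentType c)).Connected := by
  let e : c.toSimpleGraph ≃g M.coxeterGraph.induce (componentType c) :=
    { Equiv.Set.image _ c.supp Subtype.val_injective with
      map_rel_iff' := Iff.rfl }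
  exact e.connected_iff.1 c.connected_toSimpleGraph

end Components

theorem exists_isInvolutionDecomposition_of_iUnion {u g : W} {k : ℕ} {J : Fin k → Set B}
    (hJ : Pairwise fun a b => ∀ i ∈ J a, ∀ j ∈ J b, M i j = 2)
    (hconn : ∀ a, (M.coxeterGraph.induce (J a)).Connected) (hu : u ^ 2 = 1)
    (hug : u ∈ cs.conjParabolic g (⋃ a, J a)) (hneg : NegatesRoots cs u g (⋃ a, J a)) :
    ∃ v : Fin k → W, cs.IsInvolutionDecomposition u v := by
  have h := isInternalDirectProduct_conjParabolic (cs := cs) g hJ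
  obtain ⟨v, hv⟩ := h.mulEquiv.surjective ⟨u, hug⟩
  have hvu : (h.mulEquiv v : W) = u := congrArg Subtype.val hv
  have hclos : ∀ a, cs.parabolicClosure (v a) = cs.conjParabolic g (J a) := fun a => by
    refine NegatesRoots.parabolicClosure_eq (fun j hj => ?_) (v a).2
    rw [← geomRep_mulEquiv_apply h (fun b => ⟨g, J b, rfl⟩) v
      (conj_simple_mem_conjParabolic_of_mem hj), hvu, hneg j (Set.mem_iUnion_of_mem a hj)]
  have hsq : v ^ 2 = 1 := h.mulEquiv.injective <| by
    rw [map_pow, hv, map_one]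
    exact Subtype.ext hu
  refine ⟨fun a => v a, fun a => congrArg Subtype.val (congrFun hsq a), fun a b => ?_, ?_,
    fun a => ⟨g, J a, hclos a, hconn a⟩, ?_⟩
  · rcases eq_or_ne a b with rfl | hab
    · exact Commute.refl _
    · exact h.commute hab (v a).2 (v b).2
  · rw [← h.coe_mulEquiv_eq_prod_ofFn, hvu]
  · rwa [hneg.parabolicClosure_eq hug, funext hclos]

theorem exists_isInvolutionDecomposition {u : W} (hu : u ^ 2 = 1) :
    ∃ (k : ℕ) (v : Fin k → W), cs.IsInvolutionDecomposition u v := by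
  obtain ⟨g, I, hI, -, hug, hneg⟩ := exists_negatesRoots (cs := cs) hu
  have := hI.to_subtype
  have : Finite (M.coxeterGraph.induce I).ConnectedComponent := Quot.finite _
  obtain ⟨k, ⟨e⟩⟩ := Finite.exists_equiv_fin (M.coxeterGraph.induce I).ConnectedComponent
  have hI : ⋃ a, componentType (e.symm a) = I :=
    (e.symm.surjective.iUnion_comp componentType).trans iUnion_componentType
  rw [← hI] at hug hneg
  exact ⟨k, exists_isInvolutionDecomposition_of_iUnion
    (fun _ _ hab _ hi _ hj => eq_two_of_mem_componentType (e.symm.injective.ne hab) hi hj)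
    (fun _ => connected_induce_componentType _) hu hug hneg⟩

/-! ### Uniqueness of the decomposition -/

section Irreducible

theorem isParabolic_of_isIrreducibleParabolic {P : Subgroup W}
    (hP : cs.IsIrreducibleParabolic P) : cs.IsParabolic P := by
  obtain ⟨g, I, hgI, -⟩ := hP
  exact ⟨g, I, hgI⟩

theorem exists_mem_ne_one_of_isIrreducibleParabolic {P : Subgroup W}
    (hP : cs.IsIrreducibleParabolic P) : ∃ x ∈ P, x ≠ 1 := by
  obtain ⟨g, I, rfl, hI⟩ := hP
  obtain ⟨i, hi⟩ := hI.nonempty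
  exact ⟨_, conj_simple_mem_conjParabolic_of_mem hi, isReflection_ne_one ⟨g, i, rfl⟩⟩

/-- Each generating reflection lies in one factor, and two of them in different factors have
orthogonal roots, so the factor is constant along the edges of the Coxeter graph. -/
theorem exists_le_of_isIrreducibleParabolic {ι : Type*} [Fintype ι] {H : ι → Subgroup W}
    {K P : Subgroup W} (h : Subgroup.IsInternalDirectProduct H K)
    (hH : ∀ a, cs.IsParabolic (H a)) (hP : cs.IsIrreducibleParabolic P) (hPK : P ≤ K) :
    ∃ a, P ≤ H a := by
  obtain ⟨g, I, rfl, hI⟩ := hP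
  choose c hc using fun i : I => exists_mem_of_isReflection h hH ⟨g, i, rfl⟩
    (hPK (conj_simple_mem_conjParabolic_of_mem i.2))
  have hadj : ∀ i j, (M.coxeterGraph.induce I).Adj i j → c i = c j := by
    intro i j hij
    by_contra hne
    have hform := rootForm_eq_zero_of_mem_of_mem h hne (hc i) (hc j)
    rw [rootForm_geomRep, rootForm_simpleRoot_eq_zero_iff] at hform
    exact hij.2 hform
  have hreach : ∀ i j, (M.coxeterGraph.induce I).Reachable i j → c i = c j := by
    rintro i j ⟨p⟩
    induction p with
    | nil => rfl
    | cons hij _ ih => exact (hadj _ _ hij).trans ih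
  obtain ⟨i₀⟩ := hI.nonempty
  refine ⟨c i₀, conjParabolic_le_iff.2 fun i hi => ?_⟩
  rw [hreach i₀ ⟨i, hi⟩ (hI.preconnected _ _)]
  exact hc ⟨i, hi⟩

end Irreducible

/-! ### The absolute order below an involution -/

section ReflectionLength

theorem reflectionLength_le_one {t : W} (ht : cs.IsReflection t) : cs.reflectionLength t ≤ 1 := by
  simpa using cs.reflectionLength_prod_le [t] (by simpa using ht)

theorem reflectionLength_conj_le (g w : W) :
    cs.reflectionLength (g * w * g⁻¹) ≤ cs.reflectionLength w := by
  obtain ⟨l, hlen, hl, rfl⟩ := cs.exists_reflectionWord w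
  have hconj : g * l.prod * g⁻¹ = (l.map (MulAut.conj g)).prod := map_list_prod (MulAut.conj g) l
  rw [hconj, ← hlen, ← List.length_map (MulAut.conj g)]
  refine cs.reflectionLength_prod_le _ fun t ht => ?_
  obtain ⟨s, hs, rfl⟩ := List.mem_map.1 ht
  exact (hl s hs).conj g

theorem reflectionLength_conj (g w : W) :
    cs.reflectionLength (g * w * g⁻¹) = cs.reflectionLength w := by
  refine (reflectionLength_conj_le g w).antisymm ?_
  simpa [mul_assoc] using reflectionLength_conj_le (cs := cs) g⁻¹ (g * w * g⁻¹)

theorem reflectionLength_noncommProd_le {ι : Type*} (s : Finset ι) (f : ι → W)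
    (hf : (s : Set ι).Pairwise fun i j => Commute (f i) (f j)) :
    cs.reflectionLength (s.noncommProd f hf) ≤ ∑ i ∈ s, cs.reflectionLength (f i) := by
  classical
  induction s using Finset.induction_on with
  | empty => simp [reflectionLength_one]
  | insert i s hi ih =>
    rw [Finset.noncommProd_insert_of_notMem _ _ _ _ hi, Finset.sum_insert hi]
    exact (cs.reflectionLength_mul_le _ _).trans (Nat.add_le_add_left (ih _) _)

theorem absLE_one (w : W) : cs.AbsLE 1 w := by
  simp [AbsLE, reflectionLength_one]

theorem absLE_inv_mul {x y : W} (h : cs.AbsLE x y) : cs.AbsLE (x⁻¹ * y) y := by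
  have hconj : (x⁻¹ * y)⁻¹ * y = y⁻¹ * x * y⁻¹⁻¹ := by group
  rw [AbsLE, hconj, reflectionLength_conj, add_comm]
  exact h

end ReflectionLength

section BelowInvolution

variable {u : W} (hu : u ^ 2 = 1)

include hu

theorem forall_mem_parabolicClosure_of_absLE {l : List W} (hl : ∀ t ∈ l, cs.IsReflection t)
    (hlen : l.length = cs.reflectionLength l.prod) (hle : cs.AbsLE l.prod u) :
    ∀ t ∈ l, t ∈ cs.parabolicClosure u := by
  obtain ⟨m, hmlen, hm, hprod⟩ := cs.exists_reflectionWord (l.prod⁻¹ * u)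
  intro t ht
  refine mem_parabolicClosure_of_mem_reflectionWord hu (l := l ++ m)
    (List.forall_mem_append.2 ⟨hl, hm⟩) ?_ ?_ (List.mem_append_left m ht)
  · rw [List.prod_append, hprod, mul_inv_cancel_left]
  · rw [List.length_append, hlen, hmlen]
    exact hle

theorem mem_parabolicClosure_of_absLE {z : W} (hz : cs.AbsLE z u) :
    z ∈ cs.parabolicClosure u := by
  obtain ⟨l, hlen, hl, rfl⟩ := cs.exists_reflectionWord z
  exact list_prod_mem (forall_mem_parabolicClosure_of_absLE hu hl hlen hz)

end BelowInvolution

section InternalDirectProduct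

variable {ι : Type*} [Fintype ι] {H : ι → Subgroup W} {K : Subgroup W}

theorem reflectionLength_mulEquiv_le (h : Subgroup.IsInternalDirectProduct H K)
    (f : ∀ a, H a) :
    cs.reflectionLength (h.mulEquiv f) ≤ ∑ a, cs.reflectionLength (f a : W) := by
  rw [h.coe_mulEquiv_apply]
  exact reflectionLength_noncommProd_le _ _ _

theorem sum_reflectionLength_mulSingle [DecidableEq ι] (a : ι) (x : H a) :
    ∑ b, cs.reflectionLength ((Pi.mulSingle a x : ∀ b, H b) b : W) =
      cs.reflectionLength (x : W) := by
  rw [Finset.sum_eq_single a (fun b _ hb => ?_) (by simp), Pi.mulSingle_eq_same]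
  rw [Pi.mulSingle_eq_of_ne hb, Subgroup.coe_one, reflectionLength_one]

variable (hH : ∀ a, cs.IsParabolic (H a))

include hH

theorem exists_mulEquiv_eq_prod (h : Subgroup.IsInternalDirectProduct H K) {l : List W}
    (hl : ∀ t ∈ l, cs.IsReflection t) (hlK : ∀ t ∈ l, t ∈ K) :
    ∃ f : ∀ a, H a, (h.mulEquiv f : W) = l.prod ∧
      ∑ a, cs.reflectionLength (f a : W) ≤ l.length := by
  classical
  induction l with
  | nil => exact ⟨1, by simp, by simp [reflectionLength_one]⟩
  | cons t l ih =>
    obtain ⟨ht, hl⟩ := List.forall_mem_cons.1 hl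
    obtain ⟨htK, hlK⟩ := List.forall_mem_cons.1 hlK
    obtain ⟨f, hf, hlen⟩ := ih hl hlK
    obtain ⟨a, ha⟩ := exists_mem_of_isReflection h hH ht htK
    let s : ∀ b, H b := Pi.mulSingle a ⟨t, ha⟩
    have hs : ∑ b, cs.reflectionLength (s b : W) = cs.reflectionLength t :=
      sum_reflectionLength_mulSingle a ⟨t, ha⟩
    refine ⟨s * f, ?_, ?_⟩
    · rw [map_mul, Subgroup.coe_mul, h.coe_mulEquiv_mulSingle, hf, List.prod_cons]
    · calc
        ∑ b, cs.reflectionLength ((s * f) b : W)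
          ≤ ∑ b, (cs.reflectionLength (s b : W) + cs.reflectionLength (f b : W)) :=
            Finset.sum_le_sum fun b _ => cs.reflectionLength_mul_le _ _
        _ = cs.reflectionLength t + ∑ b, cs.reflectionLength (f b : W) := by
            rw [Finset.sum_add_distrib, hs]
        _ ≤ (t :: l).length := by
            rw [List.length_cons, add_comm]
            exact Nat.add_le_add hlen (reflectionLength_le_one ht)

variable {u : W} (hu : u ^ 2 = 1)
  (h : Subgroup.IsInternalDirectProduct H (cs.parabolicClosure u))

include hu

theorem reflectionLength_mulEquiv {f : ∀ a, H a} (hf : cs.AbsLE (h.mulEquiv f) u) :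
    cs.reflectionLength (h.mulEquiv f) = ∑ a, cs.reflectionLength (f a : W) := by
  refine (reflectionLength_mulEquiv_le h f).antisymm ?_
  obtain ⟨l, hlen, hl, hprod⟩ := cs.exists_reflectionWord (h.mulEquiv f)
  rw [← hprod] at hf hlen
  obtain ⟨f', hf', hle⟩ := exists_mulEquiv_eq_prod hH h hl
    (forall_mem_parabolicClosure_of_absLE hu hl hlen hf)
  obtain rfl := h.mulEquiv.injective (Subtype.ext (hf'.trans hprod))
  rwa [hlen, hprod] at hle

theorem absLE_mulEquiv_iff {f f' : ∀ a, H a} (hf' : cs.AbsLE (h.mulEquiv f') u) :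
    cs.AbsLE (h.mulEquiv f) (h.mulEquiv f') ↔ ∀ a, cs.AbsLE (f a : W) (f' a) := by
  have hinv : (h.mulEquiv f : W)⁻¹ * h.mulEquiv f' = h.mulEquiv (f⁻¹ * f') := by simp
  have hsum' := reflectionLength_mulEquiv hH hu h hf'
  constructor
  · intro hle
    have hsum := reflectionLength_mulEquiv hH hu h (hle.trans cs hf')
    have hsum_inv := reflectionLength_mulEquiv hH hu h (hinv ▸ (absLE_inv_mul hle).trans cs hf')
    have htri : ∀ a ∈ Finset.univ, cs.reflectionLength (f' a : W) ≤
        cs.reflectionLength (f a : W) + cs.reflectionLength ((f a : W)⁻¹ * f' a) := fun a _ => by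
      simpa using cs.reflectionLength_mul_le (f a : W) ((f a : W)⁻¹ * f' a)
    rw [AbsLE, hinv, hsum, hsum_inv, hsum', ← Finset.sum_add_distrib] at hle
    exact fun a => ((Finset.sum_eq_sum_iff_of_le htri).1 hle.symm a (Finset.mem_univ a)).symm
  · intro hall
    have hle := reflectionLength_mulEquiv_le (cs := cs) h f
    have hle_inv := reflectionLength_mulEquiv_le (cs := cs) h (f⁻¹ * f')
    have htri := cs.reflectionLength_mul_le (h.mulEquiv f : W)
      ((h.mulEquiv f : W)⁻¹ * h.mulEquiv f')
    have hadd : ∑ a, cs.reflectionLength (f a : W) +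
        ∑ a, cs.reflectionLength ((f⁻¹ * f') a : W) = ∑ a, cs.reflectionLength (f' a : W) := by
      rw [← Finset.sum_add_distrib]
      exact Finset.sum_congr rfl fun a _ => hall a
    rw [mul_inv_cancel_left] at htri
    rw [AbsLE]
    rw [hinv] at htri ⊢
    lia

end InternalDirectProduct

end CoxeterInvolution

namespace CoxeterSystem.IsInvolutionDecomposition

open CoxeterInvolution

variable {B W : Type*} [Group W] {M : CoxeterMatrix B} {cs : CoxeterSystem M W} {u : W} {k l : ℕ}
  {v : Fin k → W} {v' : Fin l → W}

theorem isParabolic (h : cs.IsInvolutionDecomposition u v) (a : Fin k) :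
    cs.IsParabolic (cs.parabolicClosure (v a)) :=
  isParabolic_of_isIrreducibleParabolic (h.irreducible a)

theorem mulEquiv_eq (h : cs.IsInvolutionDecomposition u v) :
    (h.directProduct.mulEquiv fun a => ⟨v a, mem_parabolicClosure (v a)⟩ : W) = u := by
  rw [h.directProduct.coe_mulEquiv_eq_prod_ofFn]
  exact h.prod_eq

theorem geomRep_apply (h : cs.IsInvolutionDecomposition u v) {a : Fin k} {g : W} {j : B}
    (hj : g * cs.simple j * g⁻¹ ∈ cs.parabolicClosure (v a)) :
    geomRep cs u (geomRep cs g (simpleRoot j)) =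
      geomRep cs (v a) (geomRep cs g (simpleRoot j)) := by
  conv_lhs => rw [← h.mulEquiv_eq]
  exact geomRep_mulEquiv_apply h.directProduct h.isParabolic _ hj

theorem eq_of_le (h : cs.IsInvolutionDecomposition u v) {a b : Fin k}
    (hab : cs.parabolicClosure (v a) ≤ cs.parabolicClosure (v b)) : a = b := by
  obtain ⟨x, hx, hx1⟩ := exists_mem_ne_one_of_isIrreducibleParabolic (h.irreducible a)
  by_contra hne
  exact hx1 (h.directProduct.eq_one_of_mem_of_mem hne hx (hab hx))

theorem exists_le (h : cs.IsInvolutionDecomposition u v)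
    (h' : cs.IsInvolutionDecomposition u v') (a : Fin k) :
    ∃ b, cs.parabolicClosure (v a) ≤ cs.parabolicClosure (v' b) :=
  exists_le_of_isIrreducibleParabolic h'.directProduct h'.isParabolic (h.irreducible a)
    (h.directProduct.le a)

theorem eq_of_parabolicClosure_eq (h : cs.IsInvolutionDecomposition u v)
    (h' : cs.IsInvolutionDecomposition u v') {a : Fin k} {b : Fin l}
    (hab : cs.parabolicClosure (v a) = cs.parabolicClosure (v' b)) : v a = v' b := by
  obtain ⟨g, I, hg⟩ := h.isParabolic a
  have hg' := hab.symm.trans hg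
  refine eq_of_mem_conjParabolic (hg ▸ mem_parabolicClosure _) (hg' ▸ mem_parabolicClosure _)
    fun j hj => ?_
  have hmem := conj_simple_mem_conjParabolic_of_mem (cs := cs) (g := g) hj
  rw [← h.geomRep_apply (hg ▸ hmem), ← h'.geomRep_apply (hg' ▸ hmem)]

theorem unique (h : cs.IsInvolutionDecomposition u v) (h' : cs.IsInvolutionDecomposition u v') :
    ∃ σ : Fin k ≃ Fin l, ∀ a, v a = v' (σ a) := by
  choose f hf using h.exists_le h'
  choose f' hf' using h'.exists_le h
  have hleft : ∀ a, f' (f a) = a := fun a => (h.eq_of_le ((hf a).trans (hf' (f a)))).symm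
  have hright : ∀ b, f (f' b) = b := fun b => (h'.eq_of_le ((hf' b).trans (hf (f' b)))).symm
  refine ⟨⟨f, f', hleft, hright⟩, fun a => h.eq_of_parabolicClosure_eq h' ((hf a).antisymm ?_)⟩
  simpa only [hleft] using hf' (f a)

theorem absLE_iff (hu : u ^ 2 = 1) (h : cs.IsInvolutionDecomposition u v)
    {f : ∀ a, cs.parabolicClosure (v a)} :
    cs.AbsLE (h.directProduct.mulEquiv f) u ↔ ∀ a, cs.AbsLE (f a : W) (v a) := by
  rw [← absLE_mulEquiv_iff (f' := fun a => ⟨v a, mem_parabolicClosure (v a)⟩) h.isParabolic hu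
    h.directProduct, h.mulEquiv_eq]
  rw [h.mulEquiv_eq]
  exact AbsLE.rfl cs u

theorem exists_orderIso (hu : u ^ 2 = 1) (h : cs.IsInvolutionDecomposition u v) :
    ∃ e : (∀ a, cs.AbsInterval 1 (v a)) ≃o cs.AbsInterval 1 u,
      ∀ x, (e x).1 = (List.ofFn fun a => (x a).1).prod := by
  let lift (x : ∀ a, cs.AbsInterval 1 (v a)) (a : Fin k) : cs.parabolicClosure (v a) :=
    ⟨(x a).1, mem_parabolicClosure_of_absLE (h.sq_eq_one a) (x a).2.2⟩
  have hlift (x) : cs.AbsLE (h.directProduct.mulEquiv (lift x)) u :=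
    (h.absLE_iff hu).2 fun a => (x a).2.2
  let F (x : ∀ a, cs.AbsInterval 1 (v a)) : cs.AbsInterval 1 u :=
    ⟨h.directProduct.mulEquiv (lift x), absLE_one _, hlift x⟩
  have hF (x y) : F x ≤ F y ↔ x ≤ y :=
    absLE_mulEquiv_iff h.isParabolic hu h.directProduct (hlift y)
  have hsurj : Function.Surjective F := by
    rintro ⟨z, hz1, hz⟩
    obtain ⟨f, hf⟩ := h.directProduct.mulEquiv.surjective ⟨z, mem_parabolicClosure_of_absLE hu hz⟩
    obtain rfl : (h.directProduct.mulEquiv f : W) = z := congrArg Subtype.val hf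
    exact ⟨fun a => ⟨f a, absLE_one _, (h.absLE_iff hu).1 hz a⟩, rfl⟩
  exact ⟨RelIso.ofSurjective (OrderEmbedding.ofMapLEIff F hF) hsurj,
    fun x => h.directProduct.coe_mulEquiv_eq_prod_ofFn (lift x)⟩

end CoxeterSystem.IsInvolutionDecomposition

theorem mainTheorem7 {B W : Type*} [Group W] {M : CoxeterMatrix B} (cs : CoxeterSystem M W)
    (u : W) (hu : u ^ 2 = 1) :
    IsLeast {P : Subgroup W | cs.IsParabolic P ∧ u ∈ P} (cs.parabolicClosure u) ∧
    Finite (cs.parabolicClosure u) ∧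
    (∃ (k : ℕ) (v : Fin k → W), cs.IsInvolutionDecomposition u v) ∧
    (∀ (k l : ℕ) (v : Fin k → W) (v' : Fin l → W),
      cs.IsInvolutionDecomposition u v → cs.IsInvolutionDecomposition u v' →
        ∃ σ : Fin k ≃ Fin l, ∀ i, v i = v' (σ i)) ∧
    (∀ (k : ℕ) (v : Fin k → W), cs.IsInvolutionDecomposition u v →
      ∃ e : (∀ i, cs.AbsInterval 1 (v i)) ≃o cs.AbsInterval 1 u,
        ∀ x, (e x).1 = (List.ofFn fun i => (x i).1).prod) :=
  ⟨CoxeterInvolution.isLeast_parabolicClosure hu, CoxeterInvolution.finite_parabolicClosure hu,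
    CoxeterInvolution.exists_isInvolutionDecomposition hu, fun _ _ _ _ h h' => h.unique h',
    fun _ _ h => h.exists_orderIso hu⟩
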